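/- A randomized catalytic Turing machine has finitely many states, a two-way read-only input tape, a binary read-write work tape (initially all $0$) and a binary read-write catalytic tape (initially holding an arbitrary string $\tau$); in each step it receives one fresh fair random bit (read-once randomness), and it halts by accepting or rejecting. For real constants $0\le\delta<1$ and $0<\epsilon\le\frac12$, let $\mathrm{BP}_{\epsilon,\delta}\text{-}\mathrm{CL}\cdot\mathrm{P}$ be the class of languages $L\subseteq\{0,1\}^*$ for which there are a randomized catalytic Turing machine $M$ and a $k\in\mathbb N$ such that, for every $n$, every input $x\in\{0,1\}^n$ and every initial catalytic content $\tau\in\{0,1\}^{c}$, where $c=n^k+k$: 1. for every outcome of the random bits, $M$ halts within $n^k+k$ steps and uses only the first $k(\lfloor\log_2 n\rfloor+1)$ cells of the work tape (read as $k$ cells if $n=0$) and the first $c$ cells of the catalytic tape; 2. $M$ correctly decides whether $x\in L$ with probability at least $\frac12+\epsilon$ over the random bits; 3. $M$ halts with $\tau$ on its catalytic tape with probability at least $1-\delta$ over the random bits. Let $\mathrm{BPP}$ be the class of languages $L\subseteq\{0,1\}^*$ decided with probability at least $\frac23$ on every input by a randomized multitape Turing machine that halts in time polynomial in the input length for all outcomes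 of its random bits. **Theorem.** Let $\delta,\epsilon$ be real constants with $\epsilon>0$, $\delta<1$ and $\delta>2\epsilon$. Then $$\mathrm{BP}_{\epsilon,\delta}\text{-}\mathrm{CL}\cdot\mathrm{P}=\mathrm{BPP}.$$ -/

import Mathlib

namespace RobustCatalytic

/-! ### Tapes and coins -/

/-- Head movements. -/
inductive Move where
  | left
  | stay
  | right

/-- A head on a one-way infinite tape; moving left from cell `0` leaves it there. -/
def Move.apply : Move → ℕ → ℕ
  | .left, p => p - 1
  | .stay, p => p
  | .right, p => p + 1

/-- The read-only input tape: the input occupies cells `1, …, n`, and the two delimiting cells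
`0` and `n + 1` are blank (`none`). -/
def inputSymbol (x : List Bool) : ℕ → Option Bool
  | 0 => none
  | i + 1 => x[i]?

/-- The input head never leaves the cells `0, …, n + 1`. -/
def moveInput (x : List Bool) (d : Move) (p : ℕ) : ℕ :=
  min (d.apply p) (x.length + 1)

/-- A one-way infinite read-write tape with its head. -/
structure RWTape (Γ : Type) where
  cells : ℕ → Γ
  head : ℕ

/-- The scanned symbol. -/
def RWTape.read {Γ : Type} (T : RWTape Γ) : Γ := T.cells T.head

/-- Write a symbol in the scanned cell, then move the head. -/
def RWTape.writeMove {Γ : Type} (T : RWTape Γ) (w : Γ × Move) : RWTape Γ where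
  cells := Function.update T.cells T.head w.1
  head := w.2.apply T.head

/-- The probability of an event when `t` fair coins are tossed independently. -/
noncomputable def coinProb (t : ℕ) (P : List Bool → Prop) : ℝ :=
  (Nat.card {r : Fin t → Bool // P (List.ofFn r)} : ℝ) / 2 ^ t

/-- The output `o` of a halted machine (`some true`: accept, `some false`: reject) is the correct
answer to the question whether `x ∈ L`. -/
def CorrectOutput (L : Language Bool) (x : List Bool) (o : Option Bool) : Prop :=
  (x ∈ L ∧ o = some true) ∨ (x ∉ L ∧ o = some false)

/-! ### Ordinary randomized Turing machines and BPP -/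

/-- A randomized multitape Turing machine: a read-only input tape, a fixed finite number of
read-write tapes (indexed by `Tapes`) over a finite alphabet, finitely many states.
In each step it is given one fresh random bit, which it may ignore.
A state `q` with `output q = some b` is halting with answer `b`. -/
structure RandTM where
  State : Type
  Alphabet : Type
  Tapes : Type
  finite_state : Finite State
  finite_alphabet : Finite Alphabet
  finite_tapes : Finite Tapes
  blank : Alphabet
  start : State
  output : State → Option Bool
  /-- State, scanned input symbol, scanned tape symbols and random bit determine the new state,
  the move of the input head, and the symbol written and head move on each tape. -/
  trans : State → Option Bool → (Tapes → Alphabet) → Bool →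
    State × Move × (Tapes → Alphabet × Move)

namespace RandTM

/-- Configurations. -/
structure Cfg (M : RandTM) where
  state : M.State
  inputHead : ℕ
  tapes : M.Tapes → RWTape M.Alphabet

/-- The initial configuration: all read-write tapes are blank. -/
def startCfg (M : RandTM) : M.Cfg where
  state := M.start
  inputHead := 0
  tapes := fun _ => ⟨fun _ => M.blank, 0⟩

/-- One step on input `x` with random bit `b`; halting configurations do not change. -/
def step (M : RandTM) (x : List Bool) (C : M.Cfg) (b : Bool) : M.Cfg :=
  match M.output C.state with
  | some _ => C
  | none =>
    let a := M.trans C.state (inputSymbol x C.inputHead) (fun j => (C.tapes j).read) b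
    { state := a.1
      inputHead := moveInput x a.2.1 C.inputHead
      tapes := fun j => (C.tapes j).writeMove (a.2.2 j) }

/-- The configuration on input `x` after `r.length` steps with random bits `r`. -/
def run (M : RandTM) (x : List Bool) (r : List Bool) : M.Cfg :=
  r.foldl (M.step x) M.startCfg

end RandTM

/-- Languages decided with probability at least `2/3` by a randomized Turing machine that halts
within `t n` steps on every input of length `n` and all random bits. -/
def BPTIME (t : ℕ → ℕ) : Set (Language Bool) :=
  {L | ∃ M : RandTM, ∀ x : List Bool,
    (∀ r : List Bool, r.length = t x.length → M.output (M.run x r).state ≠ none) ∧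
    2 / 3 ≤ coinProb (t x.length) fun r => CorrectOutput L x (M.output (M.run x r).state)}

/-- Bounded-error probabilistic polynomial time. -/
def BPP : Set (Language Bool) :=
  {L | ∃ k : ℕ, L ∈ BPTIME fun n => n ^ k + k}

/-! ### Randomized catalytic machines -/

/-- A randomized catalytic Turing machine: a read-only input tape, a binary read-write work tape,
a binary read-write catalytic tape, finitely many states. In each step it is given one fresh random
bit, which it may ignore. The answer is given by the halting state, as for `RandTM`. -/
structure CatTM where
  State : Type
  finite_state : Finite State
  start : State
  output : State → Option Bool
  /-- State, scanned input symbol, scanned work bit, scanned catalytic bit and random bit determine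
  the new state, the move of the input head, and the bit written and head move on the work tape
  and on the catalytic tape. -/
  trans : State → Option Bool → Bool → Bool → Bool →
    State × Move × (Bool × Move) × (Bool × Move)

namespace CatTM

/-- Configurations. -/
structure Cfg (M : CatTM) where
  state : M.State
  inputHead : ℕ
  work : RWTape Bool
  cat : RWTape Bool

/-- The initial configuration: the work tape is all zero and `τ` is on the catalytic tape. -/
def startCfg (M : CatTM) {c : ℕ} (τ : Fin c → Bool) : M.Cfg where
  state := M.start
  inputHead := 0
  work := ⟨fun _ => false, 0⟩
  cat := ⟨fun i => if h : i < c then τ ⟨i, h⟩ else false, 0⟩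

/-- One step on input `x` with random bit `b`; halting configurations do not change. -/
def step (M : CatTM) (x : List Bool) (C : M.Cfg) (b : Bool) : M.Cfg :=
  match M.output C.state with
  | some _ => C
  | none =>
    let a := M.trans C.state (inputSymbol x C.inputHead) C.work.read C.cat.read b
    { state := a.1
      inputHead := moveInput x a.2.1 C.inputHead
      work := C.work.writeMove a.2.2.1
      cat := C.cat.writeMove a.2.2.2 }

/-- The configuration on input `x` and initial catalytic content `τ` after `r.length` steps with
random bits `r`. -/
def run (M : CatTM) (x : List Bool) {c : ℕ} (τ : Fin c → Bool) (r : List Bool) : M.Cfg :=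
  r.foldl (M.step x) (M.startCfg τ)

/-- The catalytic tape of the configuration `C` contains `τ`. -/
def Restored {M : CatTM} {c : ℕ} (τ : Fin c → Bool) (C : M.Cfg) : Prop :=
  ∀ i : Fin c, C.cat.cells i = τ i

end CatTM

/-- The class of languages `L` with a randomized catalytic machine that, on every input `x` of
length `n` and for every initial catalytic content `τ ∈ {0,1}^(c n)`,
uses only the first `s n` work cells and the first `c n` catalytic cells, whatever the random bits,
halts within `t n` steps, whatever the random bits,
answers correctly with probability at least `1/2 + ε`, and
halts with `τ` on the catalytic tape with probability at least `1 - δ`. -/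
def BPCTimeSpace (δ ε : ℝ) (t s c : ℕ → ℕ) : Set (Language Bool) :=
  {L | ∃ M : CatTM, ∀ (x : List Bool) (τ : Fin (c x.length) → Bool),
    (∀ r : List Bool,
      (M.run x τ r).work.head < s x.length ∧ (M.run x τ r).cat.head < c x.length) ∧
    (∀ r : List Bool, r.length = t x.length → M.output (M.run x τ r).state ≠ none) ∧
    1 / 2 + ε ≤
      coinProb (t x.length) (fun r => CorrectOutput L x (M.output (M.run x τ r).state)) ∧
    1 - δ ≤ coinProb (t x.length) (fun r => CatTM.Restored τ (M.run x τ r))}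

/-- Polynomial-time catalytic logspace with reset failure probability `δ` and advantage `ε`:
polynomial time, logarithmic work space and polynomial catalytic space. -/
def BPCLP (δ ε : ℝ) : Set (Language Bool) :=
  {L | ∃ k : ℕ, L ∈ BPCTimeSpace δ ε
    (fun n => n ^ k + k) (fun n => k * (Nat.log 2 n + 1)) (fun n => n ^ k + k)}

end RobustCatalytic

namespace RobustCatalytic

/-! ### Expectations over coin tosses -/

/-- The expected value of `φ` after `t` steps driven by fair coins. -/
noncomputable def ev {α : Type} (step : α → Bool → α) : ℕ → (α → ℝ) → α → ℝ
  | 0, φ, a => φ a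
  | t + 1, φ, a => (ev step t φ (step a false) + ev step t φ (step a true)) / 2

open Classical in
/-- The real-valued indicator of a predicate. -/
noncomputable def ind {α : Type} (P : α → Prop) (a : α) : ℝ := if P a then 1 else 0

theorem ind_of_true {α : Type} {P : α → Prop} {a : α} (h : P a) : ind P a = 1 := if_pos h

theorem ind_of_false {α : Type} {P : α → Prop} {a : α} (h : ¬ P a) : ind P a = 0 := if_neg h

theorem ind_congr {α β : Type} {P : α → Prop} {Q : β → Prop} {a : α} {b : β}
    (h : P a ↔ Q b) : ind P a = ind Q b := by
  unfold ind; split_ifs <;> simp_all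

theorem coinProb_eq_sum (t : ℕ) (P : List Bool → Prop) :
    coinProb t P = (∑ r : Fin t → Bool, ind P (List.ofFn r)) / 2 ^ t := by
  classical
  unfold coinProb ind
  rw [Nat.card_eq_fintype_card, Fintype.card_subtype, Finset.sum_boole]

theorem coinProb_succ (t : ℕ) (P : List Bool → Prop) :
    coinProb (t + 1) P =
      (coinProb t (fun r => P (false :: r)) + coinProb t (fun r => P (true :: r))) / 2 := by
  simp only [coinProb_eq_sum]
  rw [← (Fin.consEquiv (fun _ : Fin (t + 1) => Bool)).sum_comp, Fintype.sum_prod_type]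
  have h : ∀ (b : Bool) (r : Fin t → Bool),
      List.ofFn (Fin.consEquiv (fun _ : Fin (t + 1) => Bool) (b, r)) = b :: List.ofFn r :=
    fun b r => List.ofFn_cons b r
  have h' : ∀ (b : Bool), ∑ r : Fin t → Bool,
      ind P (List.ofFn (Fin.consEquiv (fun _ : Fin (t + 1) => Bool) (b, r))) =
        ∑ r : Fin t → Bool, ind (fun r => P (b :: r)) (List.ofFn r) :=
    fun b => Fintype.sum_congr _ _ fun r => by rw [h]; rfl
  rw [Fintype.sum_bool, h', h', pow_succ]
  field_simp
  ring

theorem coinProb_foldl {α : Type} (step : α → Bool → α) (P : α → Prop) (t : ℕ) (a : α) :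
    coinProb t (fun r => P (r.foldl step a)) = ev step t (ind P) a := by
  induction t generalizing a with
  | zero =>
    rw [coinProb_eq_sum, Fintype.sum_unique, List.ofFn_zero, pow_zero, div_one]
    rfl
  | succ t ih => simp only [coinProb_succ, List.foldl_cons, ih, ev]

theorem ev_add {α : Type} (step : α → Bool → α) (t : ℕ) (φ ψ : α → ℝ) (u v : ℝ) (a : α) :
    ev step t (fun c => u * φ c + v * ψ c) a = u * ev step t φ a + v * ev step t ψ a := by
  induction t generalizing a with
  | zero => rfl
  | succ t ih => simp only [ev, ih]; ring

theorem ev_const {α : Type} (step : α → Bool → α) (t : ℕ) (u : ℝ) (a : α) :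
    ev step t (fun _ => u) a = u := by
  induction t generalizing a with
  | zero => rfl
  | succ t ih => simp only [ev, ih]; ring

theorem ev_mono {α : Type} (step : α → Bool → α) (t : ℕ) {φ ψ : α → ℝ} (h : ∀ c, φ c ≤ ψ c)
    (a : α) : ev step t φ a ≤ ev step t ψ a := by
  induction t generalizing a with
  | zero => exact h a
  | succ t ih => simp only [ev]; linarith [ih (step a false), ih (step a true)]

theorem ev_ind_nonneg {α : Type} (step : α → Bool → α) (t : ℕ) (P : α → Prop) (a : α) :
    0 ≤ ev step t (ind P) a := by
  rw [← ev_const step t 0 a]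
  exact ev_mono step t (fun c => by unfold ind; split_ifs <;> norm_num) a

theorem ev_ind_le_one {α : Type} (step : α → Bool → α) (t : ℕ) (P : α → Prop) (a : α) :
    ev step t (ind P) a ≤ 1 := by
  rw [← ev_const step t 1 a]
  exact ev_mono step t (fun c => by unfold ind; split_ifs <;> norm_num) a

/-- Whatever the coins, `m` steps from `a` end in a configuration satisfying `P`. -/
def Leads {α : Type} (step : α → Bool → α) (m : ℕ) (a : α) (P : α → Prop) : Prop :=
  ∀ r : List Bool, r.length = m → P (r.foldl step a)

section Leads

variable {α : Type} {step : α → Bool → α}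

theorem leads_zero {a : α} {P : α → Prop} : Leads step 0 a P ↔ P a := by
  simp [Leads]

theorem leads_succ {m : ℕ} {a : α} {P : α → Prop} :
    Leads step (m + 1) a P ↔ ∀ b, Leads step m (step a b) P := by
  constructor
  · intro h b r hr
    exact h (b :: r) (by simp [hr])
  · intro h r hr
    cases r with
    | nil => simp at hr
    | cons b r => exact h b r (by simpa using hr)

theorem Leads.trans {m n : ℕ} {a : α} {P Q : α → Prop} (h : Leads step m a P)
    (h' : ∀ b, P b → Leads step n b Q) : Leads step (m + n) a Q := by
  induction m generalizing a with
  | zero => simpa using h' a (leads_zero.1 h)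
  | succ m ih =>
    rw [Nat.add_right_comm, leads_succ]
    exact fun b => ih (leads_succ.1 h b)

theorem Leads.mono {m : ℕ} {a : α} {P Q : α → Prop} (h : Leads step m a P)
    (h' : ∀ b, P b → Q b) : Leads step m a Q :=
  fun r hr => h' _ (h r hr)

theorem Leads.ev_eq {m t : ℕ} {φ : α → ℝ} {v : ℝ} {a : α}
    (h : Leads step m a fun b => ev step t φ b = v) : ev step (m + t) φ a = v := by
  induction m generalizing a with
  | zero => simpa using leads_zero.1 h
  | succ m ih =>
    rw [Nat.add_right_comm]
    simp only [ev, ih (leads_succ.1 h _)]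
    ring

theorem leads_of_ev_eq_one {m : ℕ} {a : α} {P : α → Prop} (h : ev step m (ind P) a = 1) :
    Leads step m a P := by
  induction m generalizing a with
  | zero =>
    rw [leads_zero]
    by_contra hP
    simp [ev, ind_of_false hP] at h
  | succ m ih =>
    rw [leads_succ]
    simp only [ev] at h
    have h1 := ev_ind_le_one step m P (step a true)
    have h2 := ev_ind_le_one step m P (step a false)
    rintro (_ | _)
    · exact ih (by linarith)
    · exact ih (by linarith)

theorem Leads.ev_eq_one {m : ℕ} {a : α} {P : α → Prop} (h : Leads step m a P) :
    ev step m (ind P) a = 1 :=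
  Leads.ev_eq (t := 0) (h.mono fun _ hb => ind_of_true hb)

theorem ev_of_fixed {a : α} (h : ∀ b, step a b = a) (t : ℕ) (φ : α → ℝ) :
    ev step t φ a = φ a := by
  induction t with
  | zero => rfl
  | succ t ih => simp only [ev, h, ih]; ring

theorem leads_of_fixed {a : α} {P : α → Prop} (h : ∀ b, step a b = a) (t : ℕ) (hP : P a) :
    Leads step t a P := by
  induction t with
  | zero => exact leads_zero.2 hP
  | succ t ih => exact leads_succ.2 fun b => by rwa [h]

end Leads

/-- A coin-driven system `stepB` that simulates each coin step of `stepA` in at most `D` steps,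
exactly one of which uses its coin, and whose expected payoff from a configuration related to a
halted one is that of the latter, has the expected payoff of `stepA`. -/
theorem ev_sim {α β : Type} {stepA : α → Bool → α} {stepB : β → Bool → β} {halt : α → Prop}
    {φA : α → ℝ} {φB : β → ℝ} (R : ℕ → α → β → Prop) (D T₀ : ℕ)
    (hhalt : ∀ a, halt a → ∀ b, stepA a b = a)
    (hend : ∀ T a b, R T a b → halt a → ∀ T', T₀ ≤ T' → ev stepB T' φB b = φA a)
    (hstep : ∀ T a b, R (T + 1) a b → ¬ halt a → ∃ m₀ m₁, m₀ + 1 + m₁ ≤ D ∧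
      Leads stepB m₀ b fun b₀ => ∀ c, Leads stepB m₁ (stepB b₀ c) (R T (stepA a c))) :
    ∀ T a b, R T a b → Leads stepA T a halt → ∀ T', D * T + T₀ ≤ T' →
      ev stepB T' φB b = ev stepA T φA a := by
  intro T
  induction T with
  | zero =>
    intro a b hR hh T' hT'
    exact hend _ _ _ hR (leads_zero.1 hh) _ (by simpa using hT')
  | succ T ih =>
    intro a b hR hh T' hT'
    by_cases ha : halt a
    · rw [ev_of_fixed (hhalt a ha)]
      exact hend _ _ _ hR ha _ (by omega)
    · obtain ⟨m₀, m₁, hm, hl⟩ := hstep _ _ _ hR ha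
      have hD : D * (T + 1) = D * T + D := by ring
      obtain ⟨t, rfl⟩ : ∃ t, T' = m₀ + ((m₁ + t) + 1) := ⟨T' - (m₀ + 1 + m₁), by omega⟩
      refine Leads.ev_eq (hl.mono fun b₀ h₀ => ?_)
      have key : ∀ c, ev stepB (m₁ + t) φB (stepB b₀ c) = ev stepA T φA (stepA a c) := fun c =>
        Leads.ev_eq ((h₀ c).mono fun b' hb' => ih _ _ hb' (leads_succ.1 hh c) _ (by omega))
      simp only [ev, key]

theorem ev_congr_of_leads {α : Type} {step : α → Bool → α} {T : ℕ} {a : α} {P : α → Prop}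
    (h : Leads step T a P) {φ ψ : α → ℝ} (hφ : ∀ b, P b → φ b = ψ b) :
    ev step T φ a = ev step T ψ a := by
  induction T generalizing a with
  | zero => exact hφ a (leads_zero.1 h)
  | succ T ih => simp only [ev, ih (leads_succ.1 h _)]

theorem ev_of_leads_halt {α : Type} {step : α → Bool → α} {halt : α → Prop}
    (hhalt : ∀ a, halt a → ∀ b, step a b = a) {T T' : ℕ} {a : α} (h : Leads step T a halt)
    (hT : T ≤ T') (φ : α → ℝ) : ev step T' φ a = ev step T φ a := by
  obtain ⟨t, rfl⟩ := Nat.exists_eq_add_of_le hT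
  induction T generalizing a with
  | zero => rw [ev_of_fixed (hhalt a (leads_zero.1 h))]; rfl
  | succ T ih =>
    rw [Nat.add_right_comm]
    simp only [ev, ih (leads_succ.1 h _) (Nat.le_add_right _ _)]

theorem Leads.halt_of_le {α : Type} {step : α → Bool → α} {halt : α → Prop}
    (hhalt : ∀ a, halt a → ∀ b, step a b = a) {T T' : ℕ} {a : α} (h : Leads step T a halt)
    (hT : T ≤ T') : Leads step T' a halt := by
  obtain ⟨t, rfl⟩ := Nat.exists_eq_add_of_le hT
  exact h.trans fun b hb => leads_of_fixed (hhalt b hb) t hb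

/-! ### Polynomial bounds -/

/-- `f` is bounded by `n ^ k + k` for some `k`. -/
def PolyBdd (f : ℕ → ℕ) : Prop := ∃ k, ∀ n, f n ≤ n ^ k + k

theorem PolyBdd.mono {f g : ℕ → ℕ} (hg : PolyBdd g) (h : ∀ n, f n ≤ g n) : PolyBdd f :=
  let ⟨k, hk⟩ := hg
  ⟨k, fun n => (h n).trans (hk n)⟩

theorem polyBdd_self (k : ℕ) : PolyBdd fun n => n ^ k + k := ⟨k, fun _ => le_rfl⟩

theorem polyBdd_const (k : ℕ) : PolyBdd fun _ => k := ⟨k, fun _ => Nat.le_add_left _ _⟩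

theorem polyBdd_id : PolyBdd fun n => n := ⟨1, fun n => by simp⟩

theorem pow_add_le_of_two_le {n : ℕ} (hn : 2 ≤ n) (k : ℕ) : n ^ k + k ≤ n ^ (2 * k + 1) := by
  have h1 : 1 ≤ n ^ k := Nat.one_le_pow _ _ (by omega)
  have h2 : k + 1 ≤ n ^ (k + 1) :=
    (Nat.lt_two_pow_self (n := k + 1)).le.trans (Nat.pow_le_pow_left hn _)
  calc n ^ k + k ≤ n ^ k * (k + 1) := by nlinarith
    _ ≤ n ^ k * n ^ (k + 1) := Nat.mul_le_mul_left _ h2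
    _ = n ^ (2 * k + 1) := by rw [← pow_add]; congr 1; ring

theorem PolyBdd.mul {f g : ℕ → ℕ} (hf : PolyBdd f) (hg : PolyBdd g) :
    PolyBdd fun n => f n * g n := by
  obtain ⟨a, ha⟩ := hf
  obtain ⟨b, hb⟩ := hg
  refine ⟨(1 + a) * (1 + b) + (2 * a + 1 + (2 * b + 1)), fun n => ?_⟩
  rcases Nat.lt_or_ge n 2 with hn | hn
  · have h1 : ∀ k, n ^ k ≤ 1 := fun k => by
      calc n ^ k ≤ 1 ^ k := Nat.pow_le_pow_left (by omega) k
        _ = 1 := one_pow k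
    have := Nat.mul_le_mul ((ha n).trans (Nat.add_le_add_right (h1 a) a))
      ((hb n).trans (Nat.add_le_add_right (h1 b) b))
    dsimp only
    omega
  · have := Nat.mul_le_mul ((ha n).trans (pow_add_le_of_two_le hn a))
      ((hb n).trans (pow_add_le_of_two_le hn b))
    rw [← pow_add] at this
    have h2 : n ^ (2 * a + 1 + (2 * b + 1)) ≤
        n ^ ((1 + a) * (1 + b) + (2 * a + 1 + (2 * b + 1))) :=
      Nat.pow_le_pow_right (by omega) (by omega)
    dsimp only
    omega

theorem pow_le_pow_add_two (n k : ℕ) : n ^ k ≤ n ^ (k + 2) + 1 := by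
  rcases Nat.eq_zero_or_pos n with rfl | hn
  · have : 0 ^ k ≤ 1 := by cases k <;> simp
    exact this.trans (Nat.le_add_left _ _)
  · have := Nat.pow_le_pow_right hn (show k ≤ k + 2 by omega)
    omega

theorem PolyBdd.add {f g : ℕ → ℕ} (hf : PolyBdd f) (hg : PolyBdd g) :
    PolyBdd fun n => f n + g n := by
  have succ : ∀ {f : ℕ → ℕ}, PolyBdd f → PolyBdd fun n => f n + 1 := by
    rintro f ⟨k, hk⟩
    exact ⟨k + 2, fun n => by dsimp only; have := hk n; have := pow_le_pow_add_two n k; omega⟩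
  exact ((succ hf).mul (succ hg)).mono fun n => by nlinarith

theorem correctOutput_iff (L : Language Bool) (x : List Bool) [Decidable (x ∈ L)]
    (o : Option Bool) : CorrectOutput L x o ↔ o = some (decide (x ∈ L)) := by
  by_cases h : x ∈ L <;> simp [CorrectOutput, h]

instance : Finite Move :=
  Finite.of_injective (fun d : Move => match d with
    | .left => (0 : Fin 3)
    | .stay => 1
    | .right => 2) (by rintro (_ | _ | _) (_ | _ | _) h <;> simp_all)

theorem RWTape.writeMove_read_stay {Γ : Type} (T : RWTape Γ) :
    T.writeMove (T.read, .stay) = T := by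
  simp [RWTape.writeMove, RWTape.read, Move.apply]

theorem moveInput_stay {x : List Bool} {p : ℕ} (hp : p ≤ x.length + 1) :
    moveInput x .stay p = p := by
  simpa [moveInput, Move.apply] using hp

theorem moveInput_le (x : List Bool) (d : Move) (p : ℕ) : moveInput x d p ≤ x.length + 1 :=
  min_le_right _ _

/-! ### Deciding with a given success probability -/

namespace RandTM

/-- The configuration is halting. -/
def Halted (M : RandTM) (C : M.Cfg) : Prop := M.output C.state ≠ none

variable {M : RandTM}

theorem step_of_halted {x : List Bool} {C : M.Cfg} (h : M.Halted C) (b : Bool) :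
    M.step x C b = C := by
  unfold step Halted at *
  split
  · rfl
  · contradiction

theorem step_of_not_halted {x : List Bool} {C : M.Cfg} (h : M.output C.state = none) (b : Bool) :
    M.step x C b =
      let a := M.trans C.state (inputSymbol x C.inputHead) (fun j => (C.tapes j).read) b
      { state := a.1
        inputHead := moveInput x a.2.1 C.inputHead
        tapes := fun j => (C.tapes j).writeMove (a.2.2 j) } := by
  simp only [step, h]

end RandTM

/-- `L` is decided with probability at least `q` by a randomized Turing machine that halts in
polynomial time. -/
def RandDec (L : Language Bool) (q : ℝ) : Prop :=
  ∃ (M : RandTM) (t : ℕ → ℕ), PolyBdd t ∧ ∀ x : List Bool,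
    Leads (M.step x) (t x.length) M.startCfg M.Halted ∧
    q ≤ ev (M.step x) (t x.length) (ind fun C => CorrectOutput L x (M.output C.state)) M.startCfg

theorem RandDec.mono {L : Language Bool} {p q : ℝ} (h : RandDec L q) (hpq : p ≤ q) :
    RandDec L p :=
  let ⟨M, t, ht, hM⟩ := h
  ⟨M, t, ht, fun x => ⟨(hM x).1, hpq.trans (hM x).2⟩⟩

theorem mem_BPP_iff {L : Language Bool} : L ∈ BPP ↔ RandDec L (2 / 3) := by
  constructor
  · rintro ⟨k, M, hM⟩
    refine ⟨M, _, polyBdd_self k, fun x => ⟨(hM x).1, ?_⟩⟩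
    rw [← coinProb_foldl]
    exact (hM x).2
  · rintro ⟨M, t, ⟨k, hk⟩, hM⟩
    refine ⟨k, M, fun x => ⟨?_, ?_⟩⟩
    · exact (hM x).1.halt_of_le (fun _ h => RandTM.step_of_halted h) (hk _)
    · refine (hM x).2.trans_eq ?_
      rw [← ev_of_leads_halt (fun _ h => RandTM.step_of_halted h) (hM x).1 (hk _),
        ← coinProb_foldl]
      rfl

/-! ### Majority of three runs -/

/-- The results that a majority of three runs has to remember: none, the first one, or that the
first two differ. -/
abbrev MajorityMemory := Option (Option Bool)

/-- The number of completed runs. -/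
def MajorityMemory.count : MajorityMemory → ℕ
  | none => 0
  | some (some _) => 1
  | some none => 2

/-- The new memory, or the verdict, after another result. -/
def MajorityMemory.next : MajorityMemory → Bool → MajorityMemory ⊕ Bool
  | none, b => .inl (some (some b))
  | some (some b'), b => if b = b' then .inr b else .inl (some none)
  | some none, b => .inr b

namespace RandTM

/-- The machine that runs `M` up to three times, each time on fresh tapes, and answers with the
majority. In a state `.inl (a, none)` it rewinds the input head. -/
abbrev majority (M : RandTM) : RandTM where
  State := (MajorityMemory × Option M.State) ⊕ Bool
  Alphabet := M.Alphabet
  Tapes := M.Tapes × MajorityMemory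
  finite_state := by have := M.finite_state; infer_instance
  finite_alphabet := M.finite_alphabet
  finite_tapes := by have := M.finite_tapes; infer_instance
  blank := M.blank
  start := .inl (none, some M.start)
  output := Sum.elim (fun _ => none) some
  trans s i g c :=
    match s with
    | .inr b => (.inr b, .stay, fun j => (g j, .stay))
    | .inl (a, none) =>
      match i with
      | none => (.inl (a, some M.start), .stay, fun j => (g j, .stay))
      | some _ => (.inl (a, none), .left, fun j => (g j, .stay))
    | .inl (a, some q) =>
      match M.output q with
      | some o =>
        match a.next o with
        | .inl a' => (.inl (a', none), .left, fun j => (g j, .stay))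
        | .inr b => (.inr b, .stay, fun j => (g j, .stay))
      | none =>
        let m := M.trans q i (fun j => g (j, a)) c
        (.inl (a, some m.1), m.2.1, fun j => if j.2 = a then m.2.2 j.1 else (g j, .stay))

variable {M : RandTM}

/-- The tapes for the runs after the current one are blank. -/
def MajorityFresh (a : MajorityMemory) (B : M.majority.Cfg) : Prop :=
  ∀ a' : MajorityMemory, a.count < a'.count → ∀ j, B.tapes (j, a') = ⟨fun _ => M.blank, 0⟩

/-- `M.majority` in configuration `B` runs `M` and has reached its configuration `C`. -/
def MajorityRel (x : List Bool) (a : MajorityMemory) (C : M.Cfg) (B : M.majority.Cfg) : Prop :=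
  B.state = .inl (a, some C.state) ∧ B.inputHead = C.inputHead ∧ C.inputHead ≤ x.length + 1 ∧
    (∀ j, B.tapes (j, a) = C.tapes j) ∧ MajorityFresh a B

theorem MajorityRel.step {x : List Bool} {a : MajorityMemory} {C : M.Cfg} {B : M.majority.Cfg}
    (h : MajorityRel x a C B) (hC : M.output C.state = none) (c : Bool) :
    MajorityRel x a (M.step x C c) (M.majority.step x B c) := by
  obtain ⟨h1, h2, h3, h4, h5⟩ := h
  have hB : M.majority.output B.state = none := by rw [h1]; rfl
  have hr : ∀ j, (B.tapes (j, a)).read = (C.tapes j).read := fun j => by rw [h4]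
  rw [step_of_not_halted hC, step_of_not_halted hB]
  simp only [h1, majority, hC, h2, hr]
  refine ⟨rfl, rfl, moveInput_le _ _ _, fun j => by simp [h4], fun a' ha' j => ?_⟩
  have : a' ≠ a := by rintro rfl; exact lt_irrefl _ ha'
  simp only [this, if_false]
  rw [RWTape.writeMove_read_stay, h5 a' ha']

theorem majority_rewind {x : List Bool} {a : MajorityMemory} {B : M.majority.Cfg}
    (hs : B.state = .inl (a, none)) (hh : B.inputHead ≤ x.length)
    (ht : ∀ a' : MajorityMemory, a.count ≤ a'.count →
      ∀ j, B.tapes (j, a') = ⟨fun _ => M.blank, 0⟩) :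
    Leads (M.majority.step x) (B.inputHead + 1) B (MajorityRel x a M.startCfg) := by
  generalize hp : B.inputHead = p at hh
  have hB : M.majority.output B.state = none := by rw [hs]; rfl
  induction p generalizing B with
  | zero =>
    rw [leads_succ]
    intro c
    rw [leads_zero, step_of_not_halted hB]
    simp only [hs, majority, hp, inputSymbol, RWTape.writeMove_read_stay]
    exact ⟨rfl, moveInput_stay (Nat.zero_le _), Nat.zero_le _, fun j => ht a le_rfl j,
      fun a' ha' => ht a' ha'.le⟩
  | succ p ih =>
    rw [leads_succ]
    intro c
    have hx : x[p]? = some x[p] := List.getElem?_eq_getElem (by omega)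
    have e : M.majority.step x B c = { B with inputHead := p } := by
      rw [step_of_not_halted hB]
      simp only [hs, majority, hp, inputSymbol, hx, RWTape.writeMove_read_stay, moveInput,
        Move.apply, Nat.add_sub_cancel]
      congr 1
      omega
    rw [e]
    exact ih hs ht rfl (by omega) hB

/-- A run that asks for another one: its expected payoff is that of the other one. -/
theorem ev_majority_next {x : List Bool} {a a' : MajorityMemory} {o : Bool} {C : M.Cfg}
    {B : M.majority.Cfg} (h : MajorityRel x a C B) (ho : M.output C.state = some o)
    (ha : a.next o = .inl a') (hc : a.count < a'.count) {φ : M.majority.Cfg → ℝ} {v : ℝ} {T : ℕ}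
    (hv : ∀ B', MajorityRel x a' M.startCfg B' → ∀ T', T ≤ T' →
      ev (M.majority.step x) T' φ B' = v) {T' : ℕ} (hT : T + (x.length + 2) ≤ T') :
    ev (M.majority.step x) T' φ B = v := by
  obtain ⟨h1, h2, h3, h4, h5⟩ := h
  have hB : M.majority.output B.state = none := by rw [h1]; rfl
  have e : ∀ c, M.majority.step x B c =
      { B with state := .inl (a', none), inputHead := C.inputHead - 1 } := by
    intro c
    rw [step_of_not_halted hB]
    simp only [h1, h2, majority, ho, ha, RWTape.writeMove_read_stay, moveInput, Move.apply]
    congr 1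
    omega
  obtain ⟨t, rfl⟩ : ∃ t, T' = (C.inputHead - 1 + 1 + 1) + t := ⟨T' - (C.inputHead - 1 + 1 + 1), by omega⟩
  refine Leads.ev_eq (leads_succ.2 fun c => ?_)
  rw [e]
  have hl : C.inputHead - 1 ≤ x.length := by omega
  have hT' : T ≤ t := by omega
  exact (majority_rewind (a := a')
    (B := { B with state := .inl (a', none), inputHead := C.inputHead - 1 }) rfl hl
    fun a'' ha'' j => h5 a'' (hc.trans_le ha'') j).mono fun B' hB' => hv B' hB' _ hT'

/-- A run that settles the verdict. -/
theorem ev_majority_verdict {x : List Bool} {a : MajorityMemory} {o b β : Bool} {C : M.Cfg}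
    {B : M.majority.Cfg} (h : MajorityRel x a C B) (ho : M.output C.state = some o)
    (ha : a.next o = .inr b) {T' : ℕ} (hT : 1 ≤ T') :
    ev (M.majority.step x) T' (ind fun C => M.majority.output C.state = some β) B =
      if b = β then 1 else 0 := by
  obtain ⟨h1, h2, h3, h4, h5⟩ := h
  have hB : M.majority.output B.state = none := by rw [h1]; rfl
  obtain ⟨t, rfl⟩ : ∃ t, T' = 1 + t := ⟨T' - 1, by omega⟩
  refine Leads.ev_eq (leads_succ.2 fun c => leads_zero.2 ?_)
  have e : M.majority.output (M.majority.step x B c).state = some b := by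
    rw [step_of_not_halted hB]
    simp only [h1, majority, ho, ha, Sum.elim_inr]
  rw [ev_of_fixed (step_of_halted (by rw [Halted, e]; simp))]
  by_cases h : b = β
  · rw [if_pos h]
    exact ind_of_true (by rw [e, h])
  · rw [if_neg h]
    exact ind_of_false (by rw [e]; simpa using h)

/-- The expected payoff of `M.majority` at the start of a run of `M`, from its expected payoffs
after the two possible results. -/
theorem ev_majority_run {x : List Bool} {a : MajorityMemory} {φ : M.majority.Cfg → ℝ}
    {ψ : Bool → ℝ} {T T₀ : ℕ} (β : Bool) (hM : Leads (M.step x) T M.startCfg M.Halted)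
    (hψ : ∀ o C B, MajorityRel x a C B → M.output C.state = some o → ∀ T', T₀ ≤ T' →
      ev (M.majority.step x) T' φ B = ψ o)
    {B : M.majority.Cfg} (hB : MajorityRel x a M.startCfg B) {T' : ℕ} (hT : T + T₀ ≤ T') :
    ev (M.majority.step x) T' φ B =
      ev (M.step x) T (ind fun C => M.output C.state = some β) M.startCfg * ψ β +
      (1 - ev (M.step x) T (ind fun C => M.output C.state = some β) M.startCfg) * ψ (!β) := by
  have key := ev_sim (stepA := M.step x) (stepB := M.majority.step x) (halt := M.Halted)
    (φA := fun C => (M.output C.state).elim 0 ψ) (φB := φ) (fun _ => MajorityRel x a) 1 T₀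
    (fun _ h => step_of_halted h)
    (fun _ C B h hC T' hT' => by
      obtain ⟨o, ho⟩ := Option.ne_none_iff_exists'.1 hC
      rw [hψ o C B h ho T' hT', ho]; rfl)
    (fun _ C B h hC => ⟨0, 0, le_rfl, leads_zero.2 fun c => leads_zero.2
      (h.step (by simpa [Halted] using hC) c)⟩) T _ _ hB hM T' (by omega)
  rw [key]
  have h2 := ev_add (M.step x) T (ind fun C => M.output C.state = some β) (fun _ => 1)
    (ψ β - ψ (!β)) (ψ (!β)) M.startCfg
  rw [ev_const] at h2
  rw [ev_congr_of_leads hM (ψ := fun C =>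
    (ψ β - ψ (!β)) * ind (fun C => M.output C.state = some β) C + ψ (!β) * 1), h2]
  · ring
  · intro C hC
    obtain ⟨o, ho⟩ := Option.ne_none_iff_exists'.1 hC
    by_cases h : o = β
    · subst h
      rw [ind_of_true (P := fun C : M.Cfg => M.output C.state = some o) ho]
      simp [ho]
    · rw [ind_of_false (P := fun C : M.Cfg => M.output C.state = some β) (by simpa [ho] using h)]
      have : o = !β := by revert h; cases o <;> cases β <;> simp
      simp [ho, this]

/-- If `M` answers `β` with probability `s`, then `M.majority` answers `β` with probability
`3 s ^ 2 - 2 s ^ 3`. -/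
theorem ev_majority {x : List Bool} {T T' : ℕ} (β : Bool)
    (hM : Leads (M.step x) T M.startCfg M.Halted) (hT : 3 * T + 2 * x.length + 5 ≤ T') {s : ℝ}
    (hs : ev (M.step x) T (ind fun C => M.output C.state = some β) M.startCfg = s) :
    ev (M.majority.step x) T' (ind fun C => M.majority.output C.state = some β)
      M.majority.startCfg = 3 * s ^ 2 - 2 * s ^ 3 := by
  have run3 : ∀ B, MajorityRel x (some none) M.startCfg B → ∀ T', T + 1 ≤ T' →
      ev (M.majority.step x) T' (ind fun C => M.majority.output C.state = some β) B = s := by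
    intro B hB T' hT'
    rw [ev_majority_run (ψ := fun o => if o = β then 1 else 0) β hM
      (fun o C B h ho T' hT' => ev_majority_verdict h ho rfl hT') hB hT', hs]
    simp
  have run2 : ∀ b B, MajorityRel x (some (some b)) M.startCfg B →
      ∀ T', T + (T + 1 + (x.length + 2)) ≤ T' →
      ev (M.majority.step x) T' (ind fun C => M.majority.output C.state = some β) B =
        if b = β then s + (1 - s) * s else s * s := by
    intro b B hB T' hT'
    rw [ev_majority_run (ψ := fun o => if o = b then (if b = β then 1 else 0) else s) β hM
      (fun o C B h ho T' hT' => ?_) hB hT', hs]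
    · cases b <;> cases β <;> simp
    · by_cases hob : o = b
      · subst hob
        rw [ev_majority_verdict h ho (b := o) (by simp [MajorityMemory.next]) (by omega)]
        simp
      · rw [ev_majority_next h ho (a' := some none) (by simp [MajorityMemory.next, hob])
          (by simp [MajorityMemory.count]) run3 hT', if_neg hob]
  have hstart : MajorityRel x none M.startCfg M.majority.startCfg :=
    ⟨rfl, rfl, Nat.zero_le _, fun _ => rfl, fun _ _ _ => rfl⟩
  rw [ev_majority_run (ψ := fun o => if o = β then s + (1 - s) * s else s * s)
    (T₀ := T + (T + 1 + (x.length + 2)) + (x.length + 2)) β hM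
    (fun o C B h ho T' hT' => ?_) hstart (by omega), hs]
  · cases β <;> simp <;> ring
  · exact ev_majority_next h ho (a' := some (some o)) rfl (by simp [MajorityMemory.count])
      (run2 o) hT'

end RandTM

theorem RandDec.majority {L : Language Bool} {q : ℝ} (hq : 0 ≤ q) (h : RandDec L q) :
    RandDec L (3 * q ^ 2 - 2 * q ^ 3) := by
  classical
  obtain ⟨M, t, ht, hM⟩ := h
  refine ⟨M.majority, fun n => 3 * t n + 2 * n + 5,
    (((polyBdd_const 3).mul ht).add ((polyBdd_const 2).mul polyBdd_id)).add (polyBdd_const 5),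
    fun x => ?_⟩
  obtain ⟨h1, h2⟩ := hM x
  simp only [correctOutput_iff] at h2 ⊢
  have key := fun β => RandTM.ev_majority β h1 le_rfl rfl
  constructor
  · apply leads_of_ev_eq_one
    have hsum := ev_add (M.majority.step x) (3 * t x.length + 2 * x.length + 5)
      (ind fun C => M.majority.output C.state = some true)
      (ind fun C => M.majority.output C.state = some false) 1 1 M.majority.startCfg
    have hsum' := ev_add (M.step x) (t x.length)
      (ind fun C => M.output C.state = some true)
      (ind fun C => M.output C.state = some false) 1 1 M.startCfg
    have e : ∀ N : RandTM, (fun C : N.Cfg => 1 * ind (fun C => N.output C.state = some true) C +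
        1 * ind (fun C => N.output C.state = some false) C) = ind N.Halted := by
      intro N
      funext C
      rcases ho : N.output C.state with _ | _ | _ <;> simp [ind, ho, RandTM.Halted]
    rw [e] at hsum hsum'
    rw [h1.ev_eq_one] at hsum'
    rw [hsum, key, key]
    set s := ev (M.step x) (t x.length) (ind fun C => M.output C.state = some true) M.startCfg
    set s' := ev (M.step x) (t x.length) (ind fun C => M.output C.state = some false) M.startCfg
    have : s' = 1 - s := by linarith
    rw [this]
    ring
  · rw [key]
    set s := ev (M.step x) (t x.length)
      (ind fun C => M.output C.state = some (decide (x ∈ L))) M.startCfg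
    have hs1 : s ≤ 1 := ev_ind_le_one _ _ _ _
    have hs0 : 0 ≤ s := hq.trans h2
    have : 0 ≤ (s - q) * (3 * (s + q) - 2 * (s ^ 2 + s * q + q ^ 2)) := by
      apply mul_nonneg (by linarith)
      nlinarith [mul_nonneg hs0 (sub_nonneg.2 hs1), mul_nonneg hq (sub_nonneg.2 (h2.trans hs1)),
        sq_nonneg (s - q)]
    linarith

/-- Amplification. -/
theorem RandDec.amplify {L : Language Bool} {ε η : ℝ} (hε : 0 < ε) (hη : 0 < η)
    (h : RandDec L (1 / 2 + ε)) : RandDec L (1 - η) := by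
  rcases lt_or_ge (1 / 2) ε with hε' | hε'
  · obtain ⟨M, t, -, hM⟩ := h
    have h1 := (hM []).2
    have h2 := ev_ind_le_one (M.step []) (t ([] : List Bool).length)
      (fun C => CorrectOutput L [] (M.output C.state)) M.startCfg
    linarith
  set c := (1 / 2 - ε) * (2 + 2 * ε) with hc
  have hc0 : 0 ≤ c := mul_nonneg (by linarith) (by linarith)
  have hc1 : c < 1 := by nlinarith
  have key : ∀ i : ℕ, RandDec L (1 - (1 / 2 - ε) * c ^ i) := by
    intro i
    induction i with
    | zero => convert h using 1; ring
    | succ i ih =>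
      have hp0 : 0 ≤ c ^ i := pow_nonneg hc0 i
      have hp1 : c ^ i ≤ 1 := pow_le_one₀ hc0 hc1.le
      have he0 : 0 ≤ (1 / 2 - ε) * c ^ i := mul_nonneg (by linarith) hp0
      have he1 : (1 / 2 - ε) * c ^ i ≤ 1 / 2 - ε := mul_le_of_le_one_right (by linarith) hp1
      rw [pow_succ, ← mul_assoc]
      generalize (1 / 2 - ε) * c ^ i = e at *
      refine (ih.majority (by linarith)).mono ?_
      have : e * (3 - 2 * e) ≤ c := by
        rw [hc]
        nlinarith [mul_nonneg (sub_nonneg.2 he1) (show 0 ≤ 2 + 2 * ε - 2 * e by linarith)]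
      nlinarith [mul_le_mul_of_nonneg_left this he0]
  obtain ⟨i, hi⟩ := exists_pow_lt_of_lt_one hη hc1
  refine (key i).mono ?_
  nlinarith [pow_nonneg hc0 i]

/-! ### Randomized Turing machines simulate catalytic ones -/

namespace CatTM

/-- The configuration is halting. -/
def Halted (M : CatTM) (C : M.Cfg) : Prop := M.output C.state ≠ none

variable {M : CatTM}

theorem step_of_halted {x : List Bool} {C : M.Cfg} (h : M.Halted C) (b : Bool) :
    M.step x C b = C := by
  unfold step Halted at *
  split
  · rfl
  · contradiction

theorem step_of_not_halted {x : List Bool} {C : M.Cfg} (h : M.output C.state = none) (b : Bool) :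
    M.step x C b =
      let a := M.trans C.state (inputSymbol x C.inputHead) C.work.read C.cat.read b
      { state := a.1
        inputHead := moveInput x a.2.1 C.inputHead
        work := C.work.writeMove a.2.2.1
        cat := C.cat.writeMove a.2.2.2 } := by
  simp only [step, h]

/-- The two read-write tapes of a catalytic machine as those of an ordinary one. -/
abbrev toRandTM (M : CatTM) : RandTM where
  State := M.State
  Alphabet := Bool
  Tapes := Bool
  finite_state := M.finite_state
  finite_alphabet := inferInstance
  finite_tapes := inferInstance
  blank := false
  start := M.start
  output := M.output
  trans q i g c :=
    let m := M.trans q i (g false) (g true) c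
    (m.1, m.2.1, fun j => if j then m.2.2.2 else m.2.2.1)

/-- Corresponding configurations of `M` and `M.toRandTM`. -/
def ToRandRel (C : M.Cfg) (B : M.toRandTM.Cfg) : Prop :=
  B.state = C.state ∧ B.inputHead = C.inputHead ∧ B.tapes false = C.work ∧ B.tapes true = C.cat

theorem ToRandRel.step {x : List Bool} {C : M.Cfg} {B : M.toRandTM.Cfg} (h : ToRandRel C B)
    (hC : M.output C.state = none) (c : Bool) :
    ToRandRel (M.step x C c) (M.toRandTM.step x B c) := by
  obtain ⟨h1, h2, h3, h4⟩ := h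
  have hB : M.toRandTM.output B.state = none := by rw [h1]; exact hC
  rw [step_of_not_halted hC, RandTM.step_of_not_halted hB]
  simp [ToRandRel, toRandTM, h1, h2, h3, h4]

end CatTM

theorem randDec_of_mem_BPCLP {L : Language Bool} {δ ε : ℝ} (h : L ∈ BPCLP δ ε) :
    RandDec L (1 / 2 + ε) := by
  obtain ⟨k, M, hM⟩ := h
  refine ⟨M.toRandTM, _, polyBdd_self k, fun x => ?_⟩
  obtain ⟨-, h1, h2, -⟩ := hM x fun _ => false
  have h1' : Leads (M.step x) (x.length ^ k + k) (M.startCfg fun _ : Fin (x.length ^ k + k) => false)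
    M.Halted := h1
  have hstart : CatTM.ToRandRel (M.startCfg fun _ : Fin (x.length ^ k + k) => false)
      M.toRandTM.startCfg := by
    refine ⟨rfl, rfl, rfl, ?_⟩
    simp [RandTM.startCfg, CatTM.startCfg, CatTM.toRandTM]
  have key : ∀ P : Option Bool → Prop,
      ev (M.toRandTM.step x) (x.length ^ k + k) (ind fun C => P (M.toRandTM.output C.state))
        M.toRandTM.startCfg =
      ev (M.step x) (x.length ^ k + k) (ind fun C => P (M.output C.state))
        (M.startCfg fun _ : Fin (x.length ^ k + k) => false) := fun P =>
    ev_sim (stepA := M.step x) (halt := M.Halted) (fun _ => CatTM.ToRandRel) 1 0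
      (fun _ h => CatTM.step_of_halted h)
      (fun _ C B h hC T' _ => by
        have hB : M.toRandTM.Halted B := by rw [RandTM.Halted, h.1]; exact hC
        rw [ev_of_fixed (RandTM.step_of_halted hB)]
        exact ind_congr (by rw [h.1]))
      (fun _ C B h hC => ⟨0, 0, le_rfl, leads_zero.2 fun c => leads_zero.2
        (h.step (by simpa [CatTM.Halted] using hC) c)⟩) _ _ _ hstart h1' _ (by omega)
  constructor
  · apply leads_of_ev_eq_one
    exact (key fun o => o ≠ none).trans h1'.ev_eq_one
  · rw [key, ← coinProb_foldl]
    exact h2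

/-! ### Single-tape machines on an arbitrary initial tape -/

/-- A randomized Turing machine with a read-only input tape and a single read-write tape over a
finite alphabet. It is meant to be run from arbitrary initial tape contents. -/
structure SingleTM where
  State : Type
  Alphabet : Type
  finite_state : Finite State
  finite_alphabet : Finite Alphabet
  nonempty_alphabet : Nonempty Alphabet
  start : State
  output : State → Option Bool
  trans : State → Option Bool → Alphabet → Bool → State × Move × (Alphabet × Move)

namespace SingleTM

/-- Configurations. -/
structure Cfg (M : SingleTM) where
  state : M.State
  inputHead : ℕ
  tape : RWTape M.Alphabet

/-- The initial configuration with given tape contents. -/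
def startCfg (M : SingleTM) (w : ℕ → M.Alphabet) : M.Cfg := ⟨M.start, 0, ⟨w, 0⟩⟩

/-- One step on input `x` with random bit `b`; halting configurations do not change. -/
def step (M : SingleTM) (x : List Bool) (C : M.Cfg) (b : Bool) : M.Cfg :=
  match M.output C.state with
  | some _ => C
  | none =>
    let a := M.trans C.state (inputSymbol x C.inputHead) C.tape.read b
    { state := a.1
      inputHead := moveInput x a.2.1 C.inputHead
      tape := C.tape.writeMove a.2.2 }

/-- The configuration is halting. -/
def Halted (M : SingleTM) (C : M.Cfg) : Prop := M.output C.state ≠ none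

variable {M : SingleTM}

theorem step_of_halted {x : List Bool} {C : M.Cfg} (h : M.Halted C) (b : Bool) :
    M.step x C b = C := by
  unfold step Halted at *
  split
  · rfl
  · contradiction

theorem step_of_not_halted {x : List Bool} {C : M.Cfg} (h : M.output C.state = none) (b : Bool) :
    M.step x C b =
      let a := M.trans C.state (inputSymbol x C.inputHead) C.tape.read b
      { state := a.1
        inputHead := moveInput x a.2.1 C.inputHead
        tape := C.tape.writeMove a.2.2 } := by
  simp only [step, h]

end SingleTM

/-! ### Symbols as blocks of bits -/

/-- The phases in which a block of `K + 1` bits is read (from left to right), overwritten (from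
right to left) and left. -/
inductive BlockPhase (K : ℕ) where
  | read (j : Fin (K + 1)) (buf : Fin (K + 1) → Bool)
  | write (j : Fin (K + 1)) (g : Fin (K + 1) → Bool) (d : Move)
  | move (j : Fin (K + 1)) (d : Move)

instance (K : ℕ) : Finite (BlockPhase K) :=
  Finite.of_injective
    (fun p : BlockPhase K => match p with
      | .read j buf => (Sum.inl (j, buf) : (Fin (K + 1) × (Fin (K + 1) → Bool)) ⊕
          (Fin (K + 1) × (Fin (K + 1) → Bool) × Move) ⊕ (Fin (K + 1) × Move))
      | .write j g d => Sum.inr (Sum.inl (j, g, d))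
      | .move j d => Sum.inr (Sum.inr (j, d)))
    (by rintro (_ | _ | _) (_ | _ | _) h <;> simp_all)

/-- The phase at the start of a block. -/
def BlockPhase.init (K : ℕ) : BlockPhase K := .read 0 fun _ => false

namespace SingleTM

/-- The catalytic machine that runs `M` with each symbol stored in a block of `K + 1` bits. -/
abbrev toCat (M : SingleTM) {K : ℕ} (enc : M.Alphabet → Fin (K + 1) → Bool)
    (dec : (Fin (K + 1) → Bool) → M.Alphabet) : CatTM where
  State := M.State × BlockPhase K
  finite_state := by have := M.finite_state; infer_instance
  start := (M.start, .init K)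
  output s :=
    match s.2 with
    | .read j _ => if j = 0 then M.output s.1 else none
    | _ => none
  trans s i w c b :=
    match s with
    | (q, .read j buf) =>
      if h : j.val < K then
        ((q, .read ⟨j + 1, by omega⟩ (Function.update buf j c)), .stay, (w, .stay), (c, .right))
      else
        let m := M.trans q i (dec (Function.update buf j c)) b
        ((m.1, .write (Fin.last K) (enc m.2.2.1) m.2.2.2), m.2.1, (w, .stay), (c, .stay))
    | (q, .write j g d) =>
      if j.val = 0 then ((q, .move 0 d), .stay, (w, .stay), (g j, .stay))
      else ((q, .write ⟨j - 1, by omega⟩ g d), .stay, (w, .stay), (g j, .left))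
    | (q, .move j d) =>
      if h : j.val < K then ((q, .move ⟨j + 1, by omega⟩ d), .stay, (w, .stay), (c, d))
      else ((q, .init K), .stay, (w, .stay), (c, d))

variable {M : SingleTM} {K : ℕ} {enc : M.Alphabet → Fin (K + 1) → Bool}
  {dec : (Fin (K + 1) → Bool) → M.Alphabet}

theorem toCat_read {x : List Bool} {q : M.State} (hq : M.output q = none) (h : ℕ) :
    ∀ (n j : ℕ) (hj : j + n = K) (buf : Fin (K + 1) → Bool) (B : (M.toCat enc dec).Cfg),
      B.state = (q, .read ⟨j, by omega⟩ buf) → B.cat.head = h * (K + 1) + j →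
      B.inputHead ≤ x.length + 1 →
      (∀ i : Fin (K + 1), i.val < j → buf i = B.cat.cells (h * (K + 1) + i)) →
      Leads ((M.toCat enc dec).step x) n B fun B' =>
        ∃ buf', B'.state = (q, .read (Fin.last K) buf') ∧ B'.inputHead = B.inputHead ∧
          B'.cat = ⟨B.cat.cells, h * (K + 1) + K⟩ ∧
          ∀ i : Fin (K + 1), i.val < K → buf' i = B.cat.cells (h * (K + 1) + i) := by
  intro n
  induction n with
  | zero =>
    intro j hj buf B hs hh hi hb
    obtain rfl : j = K := hj
    refine leads_zero.2 ⟨buf, hs, rfl, ?_, hb⟩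
    rw [← hh]
  | succ n ih =>
    intro j hj buf B hs hh hi hb
    have hB : (M.toCat enc dec).output B.state = none := by
      rw [hs]; dsimp only; split_ifs <;> simp [hq]
    refine leads_succ.2 fun c => ?_
    have hjK : j < K := by omega
    have e : (M.toCat enc dec).step x B c =
        ⟨(q, .read ⟨j + 1, by omega⟩ (Function.update buf ⟨j, by omega⟩ B.cat.read)),
          B.inputHead, B.work, ⟨B.cat.cells, h * (K + 1) + (j + 1)⟩⟩ := by
      rw [CatTM.step_of_not_halted hB]
      simp only [hs, hjK, dite_true, moveInput_stay hi, RWTape.writeMove_read_stay]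
      simp [RWTape.writeMove, RWTape.read, Move.apply, hh, add_assoc]
    rw [e]
    refine (ih (j + 1) (by omega) _ _ rfl rfl hi fun i hij => ?_)
    by_cases hi' : i = ⟨j, by omega⟩
    · rw [hi', Function.update_self, RWTape.read, hh]
    · have : i.val ≠ j := fun h => hi' (Fin.ext h)
      rw [Function.update_of_ne hi']
      exact hb i (by omega)

theorem toCat_write {x : List Bool} {q : M.State} {g : Fin (K + 1) → Bool} {d : Move} (h : ℕ) :
    ∀ (j : ℕ) (hj : j < K + 1) (B : (M.toCat enc dec).Cfg),
      B.state = (q, .write ⟨j, hj⟩ g d) → B.cat.head = h * (K + 1) + j →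
      B.inputHead ≤ x.length + 1 →
      Leads ((M.toCat enc dec).step x) (j + 1) B fun B' =>
        B'.state = (q, .move 0 d) ∧ B'.inputHead = B.inputHead ∧
          B'.cat.head = h * (K + 1) ∧
          (∀ i : Fin (K + 1), i.val ≤ j → B'.cat.cells (h * (K + 1) + i) = g i) ∧
          ∀ p, p < h * (K + 1) ∨ h * (K + 1) + j < p → B'.cat.cells p = B.cat.cells p := by
  intro j
  induction j with
  | zero =>
    intro hj B hs hh hi
    have hB : (M.toCat enc dec).output B.state = none := by rw [hs]
    refine leads_succ.2 fun c => leads_zero.2 ?_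
    rw [CatTM.step_of_not_halted hB]
    simp only [hs, if_true, moveInput_stay hi, RWTape.writeMove, Move.apply, hh]
    refine ⟨trivial, trivial, rfl, fun i hi => ?_, fun p hp => Function.update_of_ne (by omega) _ _⟩
    have : i = ⟨0, hj⟩ := Fin.ext (by simpa using hi)
    subst this
    simp
  | succ j ih =>
    intro hj B hs hh hi
    have hB : (M.toCat enc dec).output B.state = none := by rw [hs]
    refine leads_succ.2 fun c => ?_
    have e : (M.toCat enc dec).step x B c =
        ⟨(q, .write ⟨j, by omega⟩ g d), B.inputHead, B.work,
          ⟨Function.update B.cat.cells (h * (K + 1) + (j + 1)) (g ⟨j + 1, hj⟩),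
            h * (K + 1) + j⟩⟩ := by
      rw [CatTM.step_of_not_halted hB]
      simp only [hs, moveInput_stay hi, RWTape.writeMove_read_stay, Nat.add_eq_zero_iff,
        one_ne_zero, and_false, if_false]
      simp [RWTape.writeMove, Move.apply, hh]
    rw [e]
    refine Leads.mono (ih (by omega) _ rfl rfl hi) ?_
    rintro B' ⟨h1, h2, h3, h4, h5⟩
    refine ⟨h1, h2, h3, fun i hij => ?_, fun p hp => ?_⟩
    · by_cases hi' : i = ⟨j + 1, hj⟩
      · subst hi'
        rw [h5 _ (by simp)]
        simp
      · have : i.val ≠ j + 1 := fun h => hi' (Fin.ext h)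
        exact h4 i (by omega)
    · rw [h5 p (by omega)]
      exact Function.update_of_ne (by omega) _ _

theorem toCat_move {x : List Bool} {q : M.State} {d : Move} :
    ∀ (n j : ℕ) (hj : j + n = K) (B : (M.toCat enc dec).Cfg),
      B.state = (q, .move ⟨j, by omega⟩ d) → B.inputHead ≤ x.length + 1 →
      Leads ((M.toCat enc dec).step x) (n + 1) B fun B' =>
        B'.state = (q, .init K) ∧ B'.inputHead = B.inputHead ∧
          B'.cat = ⟨B.cat.cells, d.apply^[n + 1] B.cat.head⟩ := by
  intro n
  induction n with
  | zero =>
    intro j hj B hs hi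
    obtain rfl : j = K := hj
    have hB : (M.toCat enc dec).output B.state = none := by rw [hs]
    refine leads_succ.2 fun c => leads_zero.2 ?_
    rw [CatTM.step_of_not_halted hB]
    simp [hs, moveInput_stay hi, RWTape.writeMove, RWTape.read]
  | succ n ih =>
    intro j hj B hs hi
    have hjK : j < K := by omega
    have hB : (M.toCat enc dec).output B.state = none := by rw [hs]
    refine leads_succ.2 fun c => ?_
    have e : (M.toCat enc dec).step x B c =
        ⟨(q, .move ⟨j + 1, by omega⟩ d), B.inputHead, B.work,
          ⟨B.cat.cells, d.apply B.cat.head⟩⟩ := by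
      rw [CatTM.step_of_not_halted hB]
      simp only [hs, hjK, dite_true, moveInput_stay hi, RWTape.writeMove_read_stay]
      simp [RWTape.writeMove, RWTape.read]
    rw [e]
    exact ih (j + 1) (by omega) _ rfl hi

theorem _root_.RobustCatalytic.Move.iterate_apply_mul (d : Move) (h K : ℕ) :
    d.apply^[K] (h * K) = d.apply h * K := by
  have left : ∀ n p : ℕ, (Move.apply .left)^[n] p = p - n := by
    intro n
    induction n with
    | zero => simp
    | succ n ih => intro p; rw [Function.iterate_succ_apply, ih, Move.apply]; omega
  have stay : ∀ n p : ℕ, (Move.apply .stay)^[n] p = p := by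
    intro n
    induction n with
    | zero => simp
    | succ n ih => intro p; rw [Function.iterate_succ_apply, ih, Move.apply]
  have right : ∀ n p : ℕ, (Move.apply .right)^[n] p = p + n := by
    intro n
    induction n with
    | zero => simp
    | succ n ih => intro p; rw [Function.iterate_succ_apply, ih, Move.apply]; omega
  cases d
  · rw [left, Move.apply, Nat.sub_mul, one_mul]
  · rw [stay, Move.apply]
  · rw [right, Move.apply, Nat.add_mul, one_mul]

/-- Corresponding configurations of `M` and `M.toCat enc dec`. -/
def ToCatRel (x : List Bool) (C : M.Cfg) (B : (M.toCat enc dec).Cfg) : Prop :=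
  B.state = (C.state, .init K) ∧ B.inputHead = C.inputHead ∧ C.inputHead ≤ x.length + 1 ∧
    B.cat.head = C.tape.head * (K + 1) ∧
    ∀ p, C.tape.cells p = dec fun i => B.cat.cells (p * (K + 1) + i)

theorem ToCatRel.step {x : List Bool} (hdec : ∀ g, dec (enc g) = g) {C : M.Cfg}
    {B : (M.toCat enc dec).Cfg} (h : ToCatRel x C B) (hC : M.output C.state = none) :
    Leads ((M.toCat enc dec).step x) K B fun B₀ => ∀ c,
      Leads ((M.toCat enc dec).step x) ((K + 1) + (K + 1)) ((M.toCat enc dec).step x B₀ c)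
        (ToCatRel x (M.step x C c)) := by
  obtain ⟨h1, h2, h3, h4, h5⟩ := h
  refine (toCat_read hC C.tape.head K 0 (by omega) (fun _ => false) B h1 h4 (h2.trans_le h3)
    (by simp)).mono ?_
  rintro B₀ ⟨buf, s1, s2, s3, s4⟩ c
  have hB₀ : (M.toCat enc dec).output B₀.state = none := by
    rw [s1]; dsimp only; split_ifs <;> simp [hC]
  have hread : dec (Function.update buf (Fin.last K) B₀.cat.read) = C.tape.read := by
    rw [RWTape.read, RWTape.read, h5]
    congr 1
    funext i
    by_cases hi : i = Fin.last K
    · subst hi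
      simp [s3]
    · rw [Function.update_of_ne hi]
      exact s4 i (Fin.val_lt_last hi)
  set m := M.trans C.state (inputSymbol x C.inputHead) C.tape.read c with hm
  have e : (M.toCat enc dec).step x B₀ c =
      ⟨(m.1, .write (Fin.last K) (enc m.2.2.1) m.2.2.2), moveInput x m.2.1 C.inputHead, B₀.work,
        ⟨B.cat.cells, C.tape.head * (K + 1) + K⟩⟩ := by
    rw [CatTM.step_of_not_halted hB₀]
    simp only [s1, Fin.val_last, lt_irrefl, dite_false, RWTape.writeMove_read_stay, hread, s2, h2]
    rw [s3]
  rw [e]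
  refine (toCat_write C.tape.head K (Nat.lt_succ_self K) _ rfl rfl (moveInput_le _ _ _)).trans ?_
  rintro B₁ ⟨t1, t2, t3, t4, t5⟩
  refine (toCat_move K 0 (by omega) B₁ t1 (t2.trans_le (moveInput_le _ _ _))).mono ?_
  rintro B₂ ⟨u1, u2, u3⟩
  rw [step_of_not_halted hC]
  refine ⟨u1, u2.trans t2, moveInput_le _ _ _, ?_, fun p => ?_⟩
  · rw [u3]
    simp only [t3, Move.iterate_apply_mul, RWTape.writeMove]
    rfl
  · rw [u3]
    simp only [RWTape.writeMove]
    by_cases hp : p = C.tape.head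
    · subst hp
      rw [Function.update_self]
      have : (fun i : Fin (K + 1) => B₁.cat.cells (C.tape.head * (K + 1) + i)) = enc m.2.2.1 :=
        funext fun i => t4 i (Nat.lt_succ_iff.1 i.2)
      rw [this, hdec]
    · rw [Function.update_of_ne hp, h5]
      congr 1
      funext i
      rw [t5]
      rcases Nat.lt_or_gt_of_ne hp with hlt | hlt
      · left
        have := Nat.mul_le_mul_right (K + 1) (Nat.succ_le_of_lt hlt)
        rw [Nat.succ_mul] at this
        have := i.2
        omega
      · right
        have := Nat.mul_le_mul_right (K + 1) (Nat.succ_le_of_lt hlt)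
        rw [Nat.succ_mul] at this
        omega

end SingleTM

/-! ### Catalytic decision -/

/-- The work head never moves. -/
def CatTM.WorkFixed (M : CatTM) : Prop := ∀ q i w c b, (M.trans q i w c b).2.2.1.2 = .stay

/-- `L` is decided with probability at least `u` by a randomized catalytic machine that does not
use its work tape, halts in polynomial time, and restores any catalytic content with probability
at least `v`. -/
def CatDec (L : Language Bool) (u v : ℝ) : Prop :=
  ∃ (M : CatTM) (t : ℕ → ℕ), M.WorkFixed ∧ PolyBdd t ∧ ∀ (x : List Bool) (c : ℕ) (τ : Fin c → Bool),
    Leads (M.step x) (t x.length) (M.startCfg τ) M.Halted ∧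
    u ≤ ev (M.step x) (t x.length) (ind fun C => CorrectOutput L x (M.output C.state))
      (M.startCfg τ) ∧
    v ≤ ev (M.step x) (t x.length) (ind (CatTM.Restored (M := M) τ)) (M.startCfg τ)

theorem exists_block_encoding (A : Type) [Finite A] [Nonempty A] :
    ∃ (K : ℕ) (enc : A → Fin (K + 1) → Bool) (dec : (Fin (K + 1) → Bool) → A),
      ∀ a, dec (enc a) = a := by
  classical
  obtain ⟨n, ⟨f⟩⟩ := Finite.exists_equiv_fin A
  refine ⟨n, fun a i => decide (i = (f a).castSucc), Function.invFun _,
    Function.leftInverse_invFun fun a b hab => ?_⟩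
  have := congrFun hab (f a).castSucc
  simpa using this

theorem catDec_of_singleTM {L : Language Bool} {q : ℝ} (M : SingleTM) (t : ℕ → ℕ)
    (ht : PolyBdd t)
    (hM : ∀ (x : List Bool) (w : ℕ → M.Alphabet),
      Leads (M.step x) (t x.length) (M.startCfg w) M.Halted ∧
      q ≤ ev (M.step x) (t x.length) (ind fun C => CorrectOutput L x (M.output C.state))
        (M.startCfg w)) : CatDec L q 0 := by
  have := M.finite_alphabet
  have := M.nonempty_alphabet
  obtain ⟨K, enc, dec, hdec⟩ := exists_block_encoding M.Alphabet
  refine ⟨M.toCat enc dec, fun n => (3 * K + 3) * t n, ?_, (polyBdd_const _).mul ht,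
    fun x c τ => ?_⟩
  · rintro ⟨q, _ | _ | _⟩ i w c b <;> simp only [SingleTM.toCat] <;> split_ifs <;> rfl
  set w : ℕ → M.Alphabet := fun p => dec fun i =>
    ((M.toCat enc dec).startCfg τ).cat.cells (p * (K + 1) + i)
  obtain ⟨h1, h2⟩ := hM x w
  have hstart : SingleTM.ToCatRel x (M.startCfg w) ((M.toCat enc dec).startCfg τ) :=
    ⟨rfl, rfl, Nat.zero_le _, (Nat.zero_mul _).symm, fun _ => rfl⟩
  have key : ∀ P : Option Bool → Prop,
      ev ((M.toCat enc dec).step x) ((3 * K + 3) * t x.length)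
        (ind fun C => P ((M.toCat enc dec).output C.state)) ((M.toCat enc dec).startCfg τ) =
      ev (M.step x) (t x.length) (ind fun C => P (M.output C.state)) (M.startCfg w) := fun P =>
    ev_sim (stepA := M.step x) (halt := M.Halted) (fun _ => SingleTM.ToCatRel x) (3 * K + 3) 0
      (fun _ h => SingleTM.step_of_halted h)
      (fun _ C B h hC T' _ => by
        have ho : (M.toCat enc dec).output B.state = M.output C.state := by
          rw [h.1]; simp [BlockPhase.init]
        have hB : (M.toCat enc dec).Halted B := by rw [CatTM.Halted, ho]; exact hC
        rw [ev_of_fixed (CatTM.step_of_halted hB)]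
        exact ind_congr (by rw [ho]))
      (fun _ C B h hC => ⟨K, (K + 1) + (K + 1), by omega,
        h.step hdec (by simpa [SingleTM.Halted] using hC)⟩) _ _ _ hstart h1 _ le_rfl
  refine ⟨?_, ?_, ev_ind_nonneg _ _ _ _⟩
  · apply leads_of_ev_eq_one
    exact (key fun o => o ≠ none).trans h1.ev_eq_one
  · rw [key fun o => CorrectOutput L x o]
    exact h2

/-! ### Shifting the contents of a track in one sweep -/

section Shift

variable {A : Type}

/-- Replace the scanned symbol by the carried one, if there is one, and carry the former. -/
def shiftCarry : Option A → A → A × Option A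
  | none, v => (v, none)
  | some o, v => (o, some v)

/-- With carry `c` at cell `i`, a sweep to the right turns `f` into `g`. -/
def ShiftsRight (c : Option A) (f g : ℕ → A) (i : ℕ) : Prop :=
  (c = none ∧ ∀ p, i ≤ p → f p = g p) ∨ (c = some (g i) ∧ ∀ p, i ≤ p → g (p + 1) = f p)

/-- With carry `c` at cell `i`, a sweep to the left turns `f` into `g`. -/
def ShiftsLeft (c : Option A) (f g : ℕ → A) (i : ℕ) : Prop :=
  (c = none ∧ ∀ p, p ≤ i → f p = g p) ∨ (c = some (g i) ∧ ∀ p, p < i → g p = f (p + 1))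

theorem ShiftsRight.fst {c : Option A} {f g : ℕ → A} {i : ℕ} (h : ShiftsRight c f g i) :
    (shiftCarry c (f i)).1 = g i := by
  obtain ⟨rfl, h⟩ | ⟨rfl, h⟩ := h
  · exact h i le_rfl
  · rfl

theorem ShiftsRight.snd {c : Option A} {f g : ℕ → A} {i : ℕ} (h : ShiftsRight c f g i) :
    ShiftsRight (shiftCarry c (f i)).2 f g (i + 1) := by
  obtain ⟨rfl, h⟩ | ⟨rfl, h⟩ := h
  · exact .inl ⟨rfl, fun p hp => h p (by omega)⟩
  · exact .inr ⟨by rw [h i le_rfl]; rfl, fun p hp => h p (by omega)⟩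

theorem ShiftsRight.join {c : Option (Option A)} {f g : ℕ → Option A} {i : ℕ}
    (h : ShiftsRight c f g i) (hf : f i = none) : c.join = g i := by
  obtain ⟨rfl, h⟩ | ⟨rfl, h⟩ := h
  · rw [← h i le_rfl, hf]; rfl
  · rfl

theorem ShiftsLeft.fst {c : Option A} {f g : ℕ → A} {i : ℕ} (h : ShiftsLeft c f g i) :
    (shiftCarry c (f i)).1 = g i := by
  obtain ⟨rfl, h⟩ | ⟨rfl, h⟩ := h
  · exact h i le_rfl
  · rfl

theorem ShiftsLeft.snd {c : Option A} {f g : ℕ → A} {i : ℕ} (h : ShiftsLeft c f g (i + 1)) :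
    ShiftsLeft (shiftCarry c (f (i + 1))).2 f g i := by
  obtain ⟨rfl, h⟩ | ⟨rfl, h⟩ := h
  · exact .inl ⟨rfl, fun p hp => h p (by omega)⟩
  · exact .inr ⟨by rw [h i (by omega)]; rfl, fun p hp => h p (by omega)⟩

/-- The stack in the middle of an operation that replaces the top of `l` by `pre`: pushes are
done, pops are not. -/
def midStack (pre l : List A) : List A := if pre.isEmpty then l else pre ++ l.tail

/-- The new top symbol, up to a pending pop. -/
def midTop (pre : List A) (o : Option A) : Option A := if pre.isEmpty then o else pre[0]?

theorem midTop_eq (pre l : List A) : midTop pre l[0]? = (midStack pre l)[0]? := by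
  cases pre <;> simp [midTop, midStack]

theorem shiftsRight_midStack {pre : List A} (hpre : pre.length ≤ 2) (l : List A) :
    ShiftsRight (pre[1]?.map some) (fun p => l[p]?) (fun p => (midStack pre l)[p]?) 1 := by
  match pre, hpre with
  | [], _ => exact .inl ⟨rfl, fun p _ => rfl⟩
  | [a], _ =>
    refine .inl ⟨rfl, fun p hp => ?_⟩
    obtain ⟨p, rfl⟩ := Nat.exists_eq_add_of_le' hp
    simp [midStack]
  | [a, b], _ =>
    refine .inr ⟨rfl, fun p hp => ?_⟩
    obtain ⟨p, rfl⟩ := Nat.exists_eq_add_of_le' hp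
    simp [midStack]

theorem shiftsLeft_midStack (pre : List A) {l : List A} {N : ℕ} (hl : l.length ≤ N + 1) :
    ShiftsLeft (if pre.isEmpty then some none else none) (fun p => (midStack pre l)[p]?)
      (fun p => (pre ++ l.tail)[p]?) N := by
  cases pre with
  | nil =>
    refine .inr ⟨?_, fun p hp => ?_⟩
    · simp [hl]
    · simp [midStack]
  | cons a pre => exact .inl ⟨rfl, fun p _ => rfl⟩

theorem midStack_last (pre : List A) {l : List A} {N : ℕ} (hl : l.length ≤ N + 1) :
    (midStack pre l)[N + 1]? = (pre ++ l.tail)[N + 1]? := by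
  cases pre with
  | nil =>
    rw [midStack, List.getElem?_eq_none (by simpa using hl), List.getElem?_eq_none (by simp; omega)]
  | cons a pre => rfl

end Shift

/-! ### A tape as two stacks -/

section Stacks

variable {A : Type}

/-- The tape `T` consists of the stack `l` to the left of the head, topmost symbol next to it, and
the stack `r` from the head on, followed by blanks. -/
def TapeRel (blank : A) (T : RWTape A) (l r : List A) : Prop :=
  T.head = l.length ∧ ∀ i, T.cells i = (l.reverse ++ r)[i]?.getD blank

/-- What replaces the tops of the left (`false`) and right (`true`) stacks of a tape when `a` is
written and the head moved by `d`; `o` is the top of the left one. -/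
def stackUpdate (o : Option A) (a : A) : Move → Bool → List A
  | .left, false => []
  | .left, true => o.toList ++ [a]
  | .stay, false => o.toList
  | .stay, true => [a]
  | .right, false => a :: o.toList
  | .right, true => []

theorem length_stackUpdate_le (o : Option A) (a : A) (d : Move) (b : Bool) :
    (stackUpdate o a d b).length ≤ 2 := by
  cases d <;> cases b <;> cases o <;> simp [stackUpdate]

theorem TapeRel.read {blank : A} {T : RWTape A} {l r : List A} (h : TapeRel blank T l r) :
    T.read = r[0]?.getD blank := by
  rw [RWTape.read, h.2, h.1, List.getElem?_append_right (by simp)]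
  simp

theorem TapeRel.writeMove {blank : A} {T : RWTape A} {l r : List A} (h : TapeRel blank T l r)
    (a : A) (d : Move) :
    TapeRel blank (T.writeMove (a, d)) (stackUpdate l[0]? a d false ++ l.tail)
      (stackUpdate l[0]? a d true ++ r.tail) := by
  obtain ⟨h1, h2⟩ := h
  have e : (stackUpdate l[0]? a d false ++ l.tail).reverse ++
      (stackUpdate l[0]? a d true ++ r.tail) = l.reverse ++ a :: r.tail := by
    cases d <;> cases l <;> simp [stackUpdate]
  constructor
  · cases d <;> cases l <;> simp [stackUpdate, RWTape.writeMove, Move.apply, h1]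
  · intro i
    rw [e]
    simp only [RWTape.writeMove, h1]
    rcases lt_trichotomy i l.length with hi | rfl | hi
    · rw [Function.update_of_ne hi.ne, h2, List.getElem?_append_left (by simpa using hi),
        List.getElem?_append_left (by simpa using hi)]
    · rw [Function.update_self, List.getElem?_append_right (by simp)]
      simp
    · rw [Function.update_of_ne hi.ne', h2, List.getElem?_append_right (by simpa using hi.le),
        List.getElem?_append_right (by simpa using hi.le)]
      obtain ⟨k, rfl⟩ : ∃ k, i = l.length + (k + 1) := ⟨i - l.length - 1, by omega⟩
      simp

end Stacks

/-! ### A single-tape machine with stacks as tracks -/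

/-- A tape cell with one track for each stack in `S` and marks on the first and last cells in
use. -/
structure TrackCell (S A : Type) where
  first : Bool
  last : Bool
  sym : S → Option A

instance (S A : Type) [Finite S] [Finite A] : Finite (TrackCell S A) :=
  Finite.of_injective (fun c : TrackCell S A => (c.first, c.last, c.sym))
    (by rintro ⟨_, _, _⟩ ⟨_, _, _⟩ h; simp_all)

/-- The states of the machine that updates all stacks in a sweep to the right, which does the
pushes, and one back, which does the pops. -/
inductive SweepState (Q S A : Type) where
  | init
  | ready (q : Q)
  | out (q : Q) (carry : S → Option (Option A)) (pop : S → Bool)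
  | extend (q : Q) (carry : S → Option (Option A)) (pop : S → Bool)
  | back (q : Q) (carry : S → Option (Option A))

instance (Q S A : Type) [Finite Q] [Finite S] [Finite A] : Finite (SweepState Q S A) :=
  Finite.of_injective
    (fun p : SweepState Q S A => match p with
      | .init => (Sum.inl none : Option Q ⊕ (Q × Bool × (S → Option (Option A)) × (S → Bool)) ⊕
          (Q × (S → Option (Option A))))
      | .ready q => Sum.inl (some q)
      | .out q c d => Sum.inr (Sum.inl (q, false, c, d))
      | .extend q c d => Sum.inr (Sum.inl (q, true, c, d))
      | .back q c => Sum.inr (Sum.inr (q, c)))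
    (by rintro (_ | _ | _ | _ | _) (_ | _ | _ | _ | _) h <;> simp_all)

namespace RandTM

/-- The single-tape machine that runs `M`. -/
abbrev toSingle (M : RandTM) : SingleTM where
  State := SweepState M.State (M.Tapes × Bool) M.Alphabet
  Alphabet := TrackCell (M.Tapes × Bool) M.Alphabet
  finite_state := by
    have := M.finite_state; have := M.finite_tapes; have := M.finite_alphabet; infer_instance
  finite_alphabet := by have := M.finite_tapes; have := M.finite_alphabet; infer_instance
  nonempty_alphabet := ⟨⟨true, true, fun _ => none⟩⟩
  start := .init
  output s :=
    match s with
    | .ready q => M.output q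
    | _ => none
  trans s i g c :=
    match s with
    | .init => (.ready M.start, .stay, ⟨true, true, fun _ => none⟩, .stay)
    | .ready q =>
      let m := M.trans q i (fun j => (g.sym (j, true)).getD M.blank) c
      let pre : M.Tapes × Bool → List M.Alphabet := fun s =>
        stackUpdate (g.sym (s.1, false)) (m.2.2 s.1).1 (m.2.2 s.1).2 s.2
      let carry := fun s => (pre s)[1]?.map some
      let pop := fun s => (pre s).isEmpty
      (if g.last then .extend m.1 carry pop else .out m.1 carry pop, m.2.1,
        ⟨g.first, false, fun s => midTop (pre s) (g.sym s)⟩, .right)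
    | .out q carry pop =>
      let carry' := fun s => (shiftCarry (carry s) (g.sym s)).2
      (if g.last then .extend q carry' pop else .out q carry' pop, .stay,
        ⟨g.first, false, fun s => (shiftCarry (carry s) (g.sym s)).1⟩, .right)
    | .extend q carry pop =>
      (.back q fun s => if pop s then some none else none, .stay,
        ⟨false, true, fun s => (carry s).join⟩, .left)
    | .back q carry =>
      let g' : TrackCell (M.Tapes × Bool) M.Alphabet :=
        ⟨g.first, g.last, fun s => (shiftCarry (carry s) (g.sym s)).1⟩
      if g.first then (.ready q, .stay, g', .stay)
      else (.back q fun s => (shiftCarry (carry s) (g.sym s)).2, .stay, g', .left)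

variable {M : RandTM}

/-- The cell `p` of a tape with stacks `l` whose last cell in use is `N`. -/
def stackCell {S A : Type} (N : ℕ) (l : S → List A) (p : ℕ) : TrackCell S A :=
  ⟨decide (p = 0), decide (p = N), fun s => (l s)[p]?⟩

/-- The sweep to the right has reached cell `i ≤ N + 1`. -/
def OutRel (N i : ℕ) (q : M.State) (h : ℕ) (pre l : M.Tapes × Bool → List M.Alphabet)
    (B : M.toSingle.Cfg) : Prop :=
  B.inputHead = h ∧ B.tape.head = i ∧
  (∃ carry, (B.state = if i = N + 1 then .extend q carry fun s => (pre s).isEmpty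
      else .out q carry fun s => (pre s).isEmpty) ∧
    ∀ s, ShiftsRight (carry s) (fun p => (l s)[p]?) (fun p => (midStack (pre s) (l s))[p]?) i) ∧
  (∀ p, p < i → B.tape.cells p = stackCell (N + 1) (fun s => midStack (pre s) (l s)) p) ∧
  ∀ p, i ≤ p → p ≤ N → B.tape.cells p = stackCell N l p

/-- The sweep to the left has reached cell `i ≤ N`. -/
def BackRel (N i : ℕ) (q : M.State) (h : ℕ) (pre l : M.Tapes × Bool → List M.Alphabet)
    (B : M.toSingle.Cfg) : Prop :=
  B.inputHead = h ∧ B.tape.head = i ∧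
  (∃ carry, B.state = .back q carry ∧
    ∀ s, ShiftsLeft (carry s) (fun p => (midStack (pre s) (l s))[p]?)
      (fun p => (pre s ++ (l s).tail)[p]?) i) ∧
  (∀ p, p ≤ i → B.tape.cells p = stackCell (N + 1) (fun s => midStack (pre s) (l s)) p) ∧
  ∀ p, i < p → p ≤ N + 1 →
    B.tape.cells p = stackCell (N + 1) (fun s => pre s ++ (l s).tail) p

/-- Ready to simulate a step in state `q`, with stacks `l`. -/
def ReadyRel (N : ℕ) (q : M.State) (h : ℕ) (l : M.Tapes × Bool → List M.Alphabet)
    (B : M.toSingle.Cfg) : Prop :=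
  B.state = .ready q ∧ B.inputHead = h ∧ B.tape.head = 0 ∧
    ∀ p, p ≤ N → B.tape.cells p = stackCell N l p

theorem leads_out {x : List Bool} {N h : ℕ} {q : M.State}
    {pre l : M.Tapes × Bool → List M.Alphabet} (hh : h ≤ x.length + 1) :
    ∀ (n i : ℕ), i + n = N + 1 → 0 < i → ∀ B, OutRel N i q h pre l B →
      Leads (M.toSingle.step x) n B (OutRel N (N + 1) q h pre l) := by
  intro n
  induction n with
  | zero =>
    rintro i hi - B hB
    obtain rfl : i = N + 1 := hi
    exact leads_zero.2 hB
  | succ n ih =>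
    rintro i hi hi0 B ⟨h1, h2, ⟨carry, h3, h4⟩, h5, h6⟩
    have hiN : i ≠ N + 1 := by omega
    rw [if_neg hiN] at h3
    have hB : M.toSingle.output B.state = none := by rw [h3]
    have hr : B.tape.read = stackCell N l i := by
      rw [RWTape.read, h2]; exact h6 i le_rfl (by omega)
    refine leads_succ.2 fun c => ih (i + 1) (by omega) (by omega) _ ?_
    rw [SingleTM.step_of_not_halted hB]
    simp only [h3, hr]
    refine ⟨?_, ?_, ⟨fun s => (shiftCarry (carry s) (l s)[i]?).2, ?_, fun s => (h4 s).snd⟩,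
      fun p hp => ?_, fun p hp hp' => ?_⟩
    · rw [h1]; exact moveInput_stay hh
    · simp [RWTape.writeMove, Move.apply, h2]
    · simp [stackCell]
    · simp only [RWTape.writeMove, h2]
      by_cases hpi : p = i
      · subst hpi
        rw [Function.update_self]
        simp only [stackCell, TrackCell.mk.injEq]
        refine ⟨trivial, ?_, funext fun s => (h4 s).fst⟩
        simp [hiN]
      · rw [Function.update_of_ne hpi]
        exact h5 p (by omega)
    · simp only [RWTape.writeMove, h2]
      rw [Function.update_of_ne (by omega)]
      exact h6 p (by omega) hp'

theorem leads_extend {x : List Bool} {N h : ℕ} {q : M.State}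
    {pre l : M.Tapes × Bool → List M.Alphabet} (hh : h ≤ x.length + 1)
    (hl : ∀ s, (l s).length ≤ N + 1) {B : M.toSingle.Cfg} (hB : OutRel N (N + 1) q h pre l B) :
    Leads (M.toSingle.step x) 1 B (BackRel N N q h pre l) := by
  obtain ⟨h1, h2, ⟨carry, h3, h4⟩, h5, h6⟩ := hB
  rw [if_pos rfl] at h3
  have hB : M.toSingle.output B.state = none := by rw [h3]
  refine leads_succ.2 fun c => leads_zero.2 ?_
  rw [SingleTM.step_of_not_halted hB]
  simp only [h3]
  refine ⟨?_, ?_, ⟨_, rfl, fun s => shiftsLeft_midStack (pre s) (hl s)⟩,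
    fun p hp => ?_, fun p hp hp' => ?_⟩
  · rw [h1]; exact moveInput_stay hh
  · simp [RWTape.writeMove, Move.apply, h2]
  · simp only [RWTape.writeMove, h2]
    rw [Function.update_of_ne (by omega)]
    exact h5 p (by omega)
  · obtain rfl : p = N + 1 := by omega
    simp only [RWTape.writeMove, h2, Function.update_self, stackCell, TrackCell.mk.injEq]
    refine ⟨by simp, by simp, funext fun s => ?_⟩
    rw [← midStack_last _ (hl s)]
    exact (h4 s).join (List.getElem?_eq_none (hl s))

theorem leads_back {x : List Bool} {N h : ℕ} {q : M.State}
    {pre l : M.Tapes × Bool → List M.Alphabet} (hh : h ≤ x.length + 1) :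
    ∀ (i : ℕ), i ≤ N → ∀ B, BackRel N i q h pre l B →
      Leads (M.toSingle.step x) (i + 1) B
        (ReadyRel (N + 1) q h fun s => pre s ++ (l s).tail) := by
  intro i
  induction i with
  | zero =>
    rintro - B ⟨h1, h2, ⟨carry, h3, h4⟩, h5, h6⟩
    have hB : M.toSingle.output B.state = none := by rw [h3]
    have hr : B.tape.read = stackCell (N + 1) (fun s => midStack (pre s) (l s)) 0 := by
      rw [RWTape.read, h2]; exact h5 0 le_rfl
    refine leads_succ.2 fun c => leads_zero.2 ?_
    rw [SingleTM.step_of_not_halted hB]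
    simp only [h3, hr]
    refine ⟨rfl, ?_, ?_, fun p hp => ?_⟩
    · rw [h1]; exact moveInput_stay hh
    · simp [RWTape.writeMove, Move.apply, h2, stackCell]
    · simp only [stackCell, decide_true, if_true, RWTape.writeMove, h2]
      by_cases hp0 : p = 0
      · subst hp0
        rw [Function.update_self]
        simp only [TrackCell.mk.injEq]
        exact ⟨by simp, by simp, funext fun s => (h4 s).fst⟩
      · rw [Function.update_of_ne hp0]
        exact h6 p (by omega) hp
  | succ i ih =>
    rintro hi B ⟨h1, h2, ⟨carry, h3, h4⟩, h5, h6⟩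
    have hB : M.toSingle.output B.state = none := by rw [h3]
    have hr : B.tape.read = stackCell (N + 1) (fun s => midStack (pre s) (l s)) (i + 1) := by
      rw [RWTape.read, h2]; exact h5 _ le_rfl
    refine leads_succ.2 fun c => ih (by omega) _ ?_
    rw [SingleTM.step_of_not_halted hB]
    simp only [h3, hr]
    simp only [stackCell, Nat.add_eq_zero_iff, one_ne_zero, and_false, decide_false,
      Bool.false_eq_true, if_false]
    refine ⟨?_, ?_, ⟨_, rfl, fun s => (h4 s).snd⟩, fun p hp => ?_, fun p hp hp' => ?_⟩
    · rw [h1]; exact moveInput_stay hh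
    · simp [RWTape.writeMove, Move.apply, h2]
    · simp only [RWTape.writeMove, h2]
      rw [Function.update_of_ne (by omega)]
      exact h5 p (by omega)
    · simp only [RWTape.writeMove, h2]
      by_cases hpi : p = i + 1
      · subst hpi
        rw [Function.update_self]
        simp only [stackCell, TrackCell.mk.injEq]
        exact ⟨by simp, trivial, funext fun s => (h4 s).fst⟩
      · rw [Function.update_of_ne hpi]
        exact h6 p (by omega) hp'

/-- `M.toSingle`, ready with stacks in the first `N + 1` cells, represents the configuration
`C` of `M`. -/
def ToSingleRel (x : List Bool) (N : ℕ) (C : M.Cfg) (B : M.toSingle.Cfg) : Prop :=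
  C.inputHead ≤ x.length + 1 ∧ ∃ l : M.Tapes × Bool → List M.Alphabet,
    ReadyRel N C.state C.inputHead l B ∧ (∀ s, (l s).length ≤ N + 1) ∧
    ∀ j, TapeRel M.blank (C.tapes j) (l (j, false)) (l (j, true))

theorem ToSingleRel.step {x : List Bool} {N : ℕ} {C : M.Cfg} {B : M.toSingle.Cfg}
    (h : ToSingleRel x N C B) (hC : M.output C.state = none) (c : Bool) :
    Leads (M.toSingle.step x) (N + (1 + (N + 1))) (M.toSingle.step x B c)
      (ToSingleRel x (N + 1) (M.step x C c)) := by
  obtain ⟨hx, l, ⟨h1, h2, h3, h4⟩, hl, ht⟩ := h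
  have hB : M.toSingle.output B.state = none := by rw [h1]; exact hC
  have hr : B.tape.read = stackCell N l 0 := by
    rw [RWTape.read, h3]; exact h4 0 (Nat.zero_le _)
  have hg : (fun j => (C.tapes j).read) = fun j => ((l (j, true))[0]?).getD M.blank :=
    funext fun j => (ht j).read
  set m := M.trans C.state (inputSymbol x C.inputHead) (fun j => (C.tapes j).read) c with hm
  set pre : M.Tapes × Bool → List M.Alphabet := fun s =>
    stackUpdate (l (s.1, false))[0]? (m.2.2 s.1).1 (m.2.2 s.1).2 s.2 with hpre
  have hpre2 : ∀ s, (pre s).length ≤ 2 := fun s => length_stackUpdate_le _ _ _ _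
  have hmi : moveInput x m.2.1 C.inputHead ≤ x.length + 1 := moveInput_le _ _ _
  have hout : OutRel N 1 m.1 (moveInput x m.2.1 C.inputHead) pre l (M.toSingle.step x B c) := by
    rw [SingleTM.step_of_not_halted hB]
    simp only [h1, hr, h2]
    simp only [stackCell, ← hg, ← hm]
    refine ⟨rfl, ?_, ⟨fun s => (pre s)[1]?.map some, ?_,
      fun s => shiftsRight_midStack (hpre2 s) (l s)⟩, fun p hp => ?_, fun p hp hp' => ?_⟩
    · simp [RWTape.writeMove, Move.apply, h3]
    · simp [hpre, eq_comm]
    · obtain rfl : p = 0 := by omega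
      simp only [RWTape.writeMove, h3, Function.update_self, stackCell, TrackCell.mk.injEq]
      exact ⟨trivial, by simp, funext fun s => midTop_eq _ _⟩
    · simp only [RWTape.writeMove, h3]
      rw [Function.update_of_ne (by omega)]
      exact h4 p hp'
  refine (leads_out hmi N 1 (by omega) one_pos _ hout).trans fun B₁ hB₁ =>
    (leads_extend hmi hl hB₁).trans fun B₂ hB₂ =>
    (leads_back hmi N le_rfl _ hB₂).mono fun B₃ hB₃ => ?_
  rw [step_of_not_halted hC]
  refine ⟨hmi, _, hB₃, fun s => ?_, fun j => (ht j).writeMove _ _⟩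
  have := hl s
  have := hpre2 s
  rw [List.length_append, List.length_tail]
  omega

theorem leads_toSingle_start {x : List Bool} (w : ℕ → M.toSingle.Alphabet) :
    Leads (M.toSingle.step x) 1 (M.toSingle.startCfg w) (ToSingleRel x 0 M.startCfg) := by
  have hB : M.toSingle.output (M.toSingle.startCfg w).state = none := rfl
  refine leads_succ.2 fun c => leads_zero.2 ?_
  rw [SingleTM.step_of_not_halted hB]
  refine ⟨Nat.zero_le _, fun _ => [], ⟨rfl, moveInput_stay (Nat.zero_le _), rfl, fun p hp => ?_⟩,
    fun _ => Nat.zero_le _, fun j => ⟨rfl, fun i => by simp [startCfg]⟩⟩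
  obtain rfl : p = 0 := by omega
  simp [SingleTM.startCfg, RWTape.writeMove, stackCell]

theorem ev_toSingle {x : List Bool} {T : ℕ} (hM : Leads (M.step x) T M.startCfg M.Halted)
    (w : ℕ → M.toSingle.Alphabet) (P : Option Bool → Prop) :
    ev (M.toSingle.step x) (1 + (2 * T + 3) * T) (ind fun C => P (M.toSingle.output C.state))
      (M.toSingle.startCfg w) =
    ev (M.step x) T (ind fun C => P (M.output C.state)) M.startCfg := by
  refine Leads.ev_eq ((leads_toSingle_start w).mono fun B hB => ?_)
  refine ev_sim (stepA := M.step x) (halt := M.Halted)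
    (fun t C B => ∃ N, N + t ≤ T ∧ ToSingleRel x N C B) (2 * T + 3) 0
    (fun _ h => step_of_halted h) ?_ ?_ T _ _ ⟨0, (Nat.zero_add T).le, hB⟩ hM _ le_rfl
  · rintro t C B ⟨N, -, -, l, hl, -⟩ hC T' -
    have ho : M.toSingle.output B.state = M.output C.state := by rw [hl.1]
    have hB : M.toSingle.Halted B := by rw [SingleTM.Halted, ho]; exact hC
    rw [ev_of_fixed (SingleTM.step_of_halted hB)]
    exact ind_congr (by rw [ho])
  · rintro t C B ⟨N, hN, hR⟩ hC
    refine ⟨0, N + (1 + (N + 1)), by omega, leads_zero.2 fun c => ?_⟩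
    exact (hR.step (by simpa [Halted] using hC) c).mono fun B' hB' => ⟨N + 1, by omega, hB'⟩

end RandTM

theorem RandDec.catDec {L : Language Bool} {q : ℝ} (h : RandDec L q) : CatDec L q 0 := by
  obtain ⟨M, t, ht, hM⟩ := h
  refine catDec_of_singleTM M.toSingle (fun n => 1 + (2 * t n + 3) * t n)
    ((polyBdd_const 1).add ((((polyBdd_const 2).mul ht).add (polyBdd_const 3)).mul ht))
    fun x w => ⟨?_, ?_⟩
  · apply leads_of_ev_eq_one
    exact (RandTM.ev_toSingle (hM x).1 w fun o => o ≠ none).trans (hM x).1.ev_eq_one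
  · rw [RandTM.ev_toSingle (hM x).1 w fun o => CorrectOutput L x o]
    exact (hM x).2

theorem CatDec.mono {L : Language Bool} {u v u' v' : ℝ} (h : CatDec L u v) (hu : u' ≤ u)
    (hv : v' ≤ v) : CatDec L u' v' :=
  let ⟨M, t, hw, ht, hM⟩ := h
  ⟨M, t, hw, ht, fun x c τ => ⟨(hM x c τ).1, hu.trans (hM x c τ).2.1, hv.trans (hM x c τ).2.2⟩⟩

/-! ### Space bounds from time bounds -/

namespace CatTM

variable {M : CatTM}

theorem work_head_foldl (hM : M.WorkFixed) (x : List Bool) (r : List Bool) (C : M.Cfg) :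
    (r.foldl (M.step x) C).work.head = C.work.head := by
  induction r generalizing C with
  | nil => rfl
  | cons b r ih =>
    rw [List.foldl_cons, ih]
    unfold step
    split
    · rfl
    · simp [RWTape.writeMove, hM _ _ _ _ _, Move.apply]

theorem cat_head_foldl_le (x : List Bool) (r : List Bool) (C : M.Cfg) :
    (r.foldl (M.step x) C).cat.head ≤ C.cat.head + r.length := by
  induction r generalizing C with
  | nil => exact le_rfl
  | cons b r ih =>
    have h : ∀ (d : Move) (p : ℕ), d.apply p ≤ p + 1 := by
      rintro (_ | _ | _) p <;> simp only [Move.apply] <;> omega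
    have h1 : (M.step x C b).cat.head ≤ C.cat.head + 1 := by
      unfold step
      split
      · exact Nat.le_succ _
      · exact h _ _
    have h2 := ih (M.step x C b)
    rw [List.foldl_cons, List.length_cons]
    omega

theorem cat_head_foldl_le_of_halts {x : List Bool} {C : M.Cfg} {T : ℕ}
    (h : Leads (M.step x) T C M.Halted) (r : List Bool) :
    (r.foldl (M.step x) C).cat.head ≤ C.cat.head + T := by
  rcases le_total r.length T with hr | hr
  · exact (cat_head_foldl_le x r C).trans (by omega)
  · have h1 : (r.take T).length = T := by simp [hr]
    have h2 : ∀ (s : List Bool) (D : M.Cfg), M.Halted D → s.foldl (M.step x) D = D := by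
      intro s D hD
      induction s with
      | nil => rfl
      | cons b s ih => rw [List.foldl_cons, step_of_halted hD, ih]
    rw [← List.take_append_drop T r, List.foldl_append, h2 _ _ (h _ h1)]
    exact (cat_head_foldl_le x _ C).trans (by omega)

end CatTM

theorem CatDec.mem_BPCLP {L : Language Bool} {δ ε : ℝ} (h : CatDec L (1 / 2 + ε) (1 - δ)) :
    L ∈ BPCLP δ ε := by
  obtain ⟨M, t, hw, ⟨k, hk⟩, hM⟩ := h
  have hlt : ∀ n, t n < n ^ (k + 2) + (k + 2) := fun n => by
    have := hk n
    have := pow_le_pow_add_two n k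
    omega
  refine ⟨k + 2, M, fun x τ => ?_⟩
  obtain ⟨h1, h2, h3⟩ := hM x _ τ
  have hev := ev_of_leads_halt (fun _ h => CatTM.step_of_halted h) h1 (hlt _).le
  refine ⟨fun r => ⟨?_, ?_⟩, ?_, ?_, ?_⟩
  · rw [CatTM.run, CatTM.work_head_foldl hw]
    exact Nat.mul_pos (by omega) (by omega)
  · refine (CatTM.cat_head_foldl_le_of_halts h1 r).trans_lt ?_
    simpa [CatTM.startCfg] using hlt x.length
  · exact h1.halt_of_le (fun _ h => CatTM.step_of_halted h) (hlt _).le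
  · refine (h2.trans_eq (hev _).symm).trans_eq ?_
    rw [← coinProb_foldl]
    rfl
  · refine (h3.trans_eq (hev _).symm).trans_eq ?_
    rw [← coinProb_foldl]
    rfl

/-! ### Mixtures of catalytic machines -/

namespace CatTM

/-- Expectations are preserved by an embedding of machines. -/
theorem ev_of_embeds {M' N' : CatTM} (ι : M'.State → N'.State)
    (hout : ∀ q, N'.output (ι q) = M'.output q)
    (htrans : ∀ q i w c b, N'.trans (ι q) i w c b =
      (ι (M'.trans q i w c b).1, (M'.trans q i w c b).2))
    {x : List Bool} {T T' : ℕ} (hT : T ≤ T') {C : M'.Cfg} (hC : Leads (M'.step x) T C M'.Halted)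
    (P : Option Bool → (ℕ → Bool) → Prop) :
    ev (N'.step x) T' (ind fun B => P (N'.output B.state) B.cat.cells)
      ⟨ι C.state, C.inputHead, C.work, C.cat⟩ =
    ev (M'.step x) T (ind fun C => P (M'.output C.state) C.cat.cells) C := by
  refine ev_sim (stepA := M'.step x) (stepB := N'.step x) (halt := M'.Halted)
    (fun _ C B => B = ⟨ι C.state, C.inputHead, C.work, C.cat⟩) 1 0
    (fun _ h => step_of_halted h) ?_ ?_ T _ _ rfl hC _ (by omega)
  · rintro _ C B rfl hC T' -
    have hB : N'.Halted ⟨ι C.state, C.inputHead, C.work, C.cat⟩ := by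
      rw [Halted, hout]; exact hC
    rw [ev_of_fixed (step_of_halted hB)]
    exact ind_congr (by rw [hout])
  · rintro _ C B rfl hC
    have hC' : M'.output C.state = none := by simpa [Halted] using hC
    refine ⟨0, 0, le_rfl, leads_zero.2 fun c => leads_zero.2 ?_⟩
    rw [step_of_not_halted hC', step_of_not_halted (by rw [hout]; exact hC')]
    simp only [htrans]

/-- The machine that tosses a coin to choose which of two machines to run. -/
abbrev mix (M N : CatTM) : CatTM where
  State := Option (M.State ⊕ N.State)
  finite_state := by have := M.finite_state; have := N.finite_state; infer_instance
  start := none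
  output s := s.bind (Sum.elim M.output N.output)
  trans s i w c b :=
    match s with
    | none => (some (if b then .inr N.start else .inl M.start), .stay, (w, .stay), (c, .stay))
    | some (.inl q) =>
      let m := M.trans q i w c b
      (some (.inl m.1), m.2)
    | some (.inr q) =>
      let m := N.trans q i w c b
      (some (.inr m.1), m.2)

variable {M N : CatTM}

theorem ev_mix {x : List Bool} {c : ℕ} {τ : Fin c → Bool} {S T U : ℕ}
    (hM : Leads (M.step x) S (M.startCfg τ) M.Halted)
    (hN : Leads (N.step x) T (N.startCfg τ) N.Halted) (hS : S ≤ U) (hT : T ≤ U)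
    (P : Option Bool → (ℕ → Bool) → Prop) :
    ev ((M.mix N).step x) (U + 1) (ind fun B => P ((M.mix N).output B.state) B.cat.cells)
      ((M.mix N).startCfg τ) =
    (ev (M.step x) S (ind fun C => P (M.output C.state) C.cat.cells) (M.startCfg τ) +
      ev (N.step x) T (ind fun C => P (N.output C.state) C.cat.cells) (N.startCfg τ)) / 2 := by
  rw [← ev_of_embeds (N' := M.mix N) (fun q => some (.inl q)) (fun _ => rfl)
      (fun _ _ _ _ _ => rfl) hS hM P,
    ← ev_of_embeds (N' := M.mix N) (fun q => some (.inr q)) (fun _ => rfl)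
      (fun _ _ _ _ _ => rfl) hT hN P]
  have h : (M.mix N).output ((M.mix N).startCfg τ).state = none := rfl
  have e : ∀ b, (M.mix N).step x ((M.mix N).startCfg τ) b =
      { (M.mix N).startCfg τ with state := some (if b then .inr N.start else .inl M.start) } := by
    intro b
    rw [step_of_not_halted h]
    simp only [startCfg, moveInput_stay (Nat.zero_le _), RWTape.writeMove_read_stay]
  simp only [ev, e]
  rfl

end CatTM

theorem CatDec.mix {L : Language Bool} {u v u' v' : ℝ} (h : CatDec L u v) (h' : CatDec L u' v') :
    CatDec L ((u + u') / 2) ((v + v') / 2) := by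
  obtain ⟨M, s, hMw, hs, hM⟩ := h
  obtain ⟨N, t, hNw, ht, hN⟩ := h'
  refine ⟨M.mix N, fun n => s n + t n + 1, ?_, (hs.add ht).add (polyBdd_const 1),
    fun x c τ => ?_⟩
  · rintro (_ | _ | _) i w c b
    · rfl
    · exact hMw _ _ _ _ _
    · exact hNw _ _ _ _ _
  obtain ⟨h1, h2, h3⟩ := hM x c τ
  obtain ⟨h1', h2', h3'⟩ := hN x c τ
  have key := CatTM.ev_mix h1 h1' (Nat.le_add_right _ (t x.length)) (Nat.le_add_left _ _)
  refine ⟨leads_of_ev_eq_one ((key fun o _ => o ≠ none).trans ?_),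
    (?_ : _ ≤ _).trans_eq (key fun o _ => CorrectOutput L x o).symm,
    (?_ : _ ≤ _).trans_eq (key fun _ f => ∀ i : Fin c, f i = τ i).symm⟩
  · have e : ev (M.step x) (s x.length) (ind fun C => M.output C.state ≠ none) (M.startCfg τ) = 1 :=
      h1.ev_eq_one
    have e' : ev (N.step x) (t x.length) (ind fun C => N.output C.state ≠ none) (N.startCfg τ) = 1 :=
      h1'.ev_eq_one
    rw [e, e']
    norm_num
  · linarith
  · have e := h3
    have e' := h3'
    unfold CatTM.Restored at e e'
    linarith

/-- The catalytic machine that answers with a coin toss. -/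
abbrev CatTM.coinFlip : CatTM where
  State := Option Bool
  finite_state := inferInstance
  start := none
  output := id
  trans _ _ w c b := (some b, .stay, (w, .stay), (c, .stay))

theorem catDec_coinFlip (L : Language Bool) : CatDec L (1 / 2) 1 := by
  classical
  refine ⟨CatTM.coinFlip, fun _ => 1, fun _ _ _ _ _ => rfl, polyBdd_const 1, fun x c τ => ?_⟩
  have h : CatTM.coinFlip.output (CatTM.coinFlip.startCfg τ).state = none := rfl
  have e : ∀ b, CatTM.coinFlip.step x (CatTM.coinFlip.startCfg τ) b =
      { CatTM.coinFlip.startCfg τ with state := some b } := by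
    intro b
    rw [CatTM.step_of_not_halted h]
    simp only [CatTM.startCfg, moveInput_stay (Nat.zero_le _), RWTape.writeMove_read_stay]
  refine ⟨leads_succ.2 fun b => leads_zero.2 ?_, ?_, ?_⟩
  · rw [e]
    simp [CatTM.Halted]
  · simp only [ev, e, correctOutput_iff]
    by_cases hx : x ∈ L <;> simp [ind, hx]
  · have hr : ∀ b, CatTM.Restored τ ({ CatTM.coinFlip.startCfg τ with state := some b } :
        CatTM.coinFlip.Cfg) := fun b i => by simp [CatTM.startCfg]
    simp only [ev, e, ind_of_true (hr _)]
    norm_num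

theorem CatDec.mix_dyadic {L : Language Bool} {u v u' v' : ℝ} (h : CatDec L u v)
    (h' : CatDec L u' v') : ∀ m a : ℕ, a ≤ 2 ^ m →
      CatDec L (u' + a / 2 ^ m * (u - u')) (v' + a / 2 ^ m * (v - v')) := by
  intro m
  induction m with
  | zero =>
    intro a ha
    obtain rfl | rfl : a = 0 ∨ a = 1 := by omega
    · simpa using h'
    · simpa using h
  | succ m ih =>
    intro a ha
    have h2 : (2 : ℝ) ^ m ≠ 0 := by positivity
    rcases le_total a (2 ^ m) with ham | ham
    · convert h'.mix (ih a ham) using 1 <;> · rw [pow_succ]; field_simp; ring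
    · obtain ⟨b, rfl⟩ := Nat.exists_eq_add_of_le ham
      convert h.mix (ih b (by rw [pow_succ] at ha; omega)) using 1 <;>
      · rw [pow_succ]; push_cast; field_simp; ring

theorem exists_dyadic_btwn {a b : ℝ} (ha : 0 ≤ a) (hab : a < b) :
    ∃ m n : ℕ, a < n / 2 ^ m ∧ (n : ℝ) / 2 ^ m < b := by
  obtain ⟨m, hm⟩ := exists_pow_lt_of_lt_one (sub_pos.2 hab) (by norm_num : (1 / 2 : ℝ) < 1)
  have h2 : (0 : ℝ) < 2 ^ m := by positivity
  refine ⟨m, ⌊a * 2 ^ m⌋₊ + 1, ?_, ?_⟩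
  · rw [lt_div_iff₀ h2]
    exact_mod_cast Nat.lt_floor_add_one (a * 2 ^ m)
  · rw [div_lt_iff₀ h2]
    have h3 := Nat.floor_le (mul_nonneg ha h2.le)
    rw [one_div, inv_pow, inv_lt_iff_one_lt_mul₀ h2] at hm
    push_cast
    nlinarith

end RobustCatalytic

theorem mainTheorem4 (δ ε : ℝ) (hε : 0 < ε) (hδ : δ < 1) (hδε : 2 * ε < δ) :
    RobustCatalytic.BPCLP δ ε = RobustCatalytic.BPP := by
  ext L
  rw [RobustCatalytic.mem_BPP_iff]
  constructor
  · intro h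
    exact ((RobustCatalytic.randDec_of_mem_BPCLP h).amplify hε (η := 1 / 3) (by norm_num)).mono
      (by norm_num)
  · intro h
    obtain ⟨m, a, h1, h2⟩ := RobustCatalytic.exists_dyadic_btwn (by positivity) hδε
    have ham : a ≤ 2 ^ m := by
      have : (a : ℝ) / 2 ^ m ≤ 1 := h2.le.trans hδ.le
      rw [div_le_one (by positivity)] at this
      exact_mod_cast this
    set p : ℝ := a / 2 ^ m
    have hp : 0 < p := by linarith
    have hsim := ((h.mono (p := 1 / 2 + 1 / 6) (by norm_num)).amplify (by norm_num)
      (η := (p / 2 - ε) / p) (div_pos (by linarith) hp)).catDec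
    refine ((hsim.mix_dyadic (RobustCatalytic.catDec_coinFlip L) m a ham).mono ?_ ?_).mem_BPCLP
    · have : p * ((p / 2 - ε) / p) = p / 2 - ε := by field_simp
      nlinarith
    · linarith
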